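/- Let $h_1,h_2,h_3\in\mathbb R$, $v_{12},v_{23}\in\mathbb C\setminus\{0\}$, $T\ge 0$, and let $$H_0=\mathrm{diag}(h_1,h_2,h_3),\qquad V=\begin{pmatrix}0&v_{12}&0\\ \overline{v_{12}}&0&v_{23}\\ 0&\overline{v_{23}}&0\end{pmatrix},\qquad O=\mathrm{diag}(\lambda_1,\lambda_2,\lambda_3),\quad \lambda_1>\lambda_3>\lambda_2 .$$ Assume that the system is harmonic: $h_2-h_1=h_3-h_2=\omega\neq 0$. For $f\in L_2([0,T],\mathbb R)$ let $U^f_t$ be the absolutely continuous solution on $[0,T]$ of $i\,\frac{d}{dt}U_t^f=(H_0+f(t)V)U_t^f$, $U_0^f=\mathbb I$, and put $J_O(f)=\mathrm{Tr}\,[U_T^f\rho_0(U_T^f)^\dagger O]$ with $\rho_0=|3\rangle\langle 3|$. Let $J_O^{(n)}(f)$ be the Fréchet differential of order $n$ of $J_O$ at $f$, and let $f_0\equiv 0$. With $V_t=e^{itH_0}Ve^{-itH_0}$ define $$A^n_{lk}\langle f\rangle=\int_0^T dt_1\int_0^{t_1}dt_2\cdots\int_0^{t_{n-1}}dt_n\,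 f(t_1)\cdots f(t_n)\,\langle l|V_{t_1}\cdots V_{t_n}|k\rangle ,$$ $\mathfrak H^0=L_2([0,T],\mathbb R)$, $\mathfrak H^1=\{f\in\mathfrak H^0: A^1_{23}\langle f\rangle=0\}$ and $\mathfrak H^3=\{f\in\mathfrak H^1: A^3_{23}\langle f\rangle=0\}$. A control $f$ is a trap of order $n$ for $J_O$ if (1) $f$ is not a point of global maximum of $J_O$, and (2) $J_O$ is $n$ times continuously differentiable at $f$, $J_O(f+\delta f)=J_O(f)+R(\delta f)+o(\|\delta f\|^n)$ as $\|\delta f\|\to0$ with $R(\delta f)=\sum_{j=2}^n\frac1{j!}J_O^{(j)}(f)(\delta f,\dots,\delta f)$, where $R\ne0$ and for every $\delta f\in\mathfrak H^0$ there is $\varepsilon>0$ such that $R(t\,\delta f)\le0$ for all $t\in(-\varepsilon,\varepsilon)$. Then $J_O$ is smooth at $f_0$ and, as $\|\delta f\|\to0$, $$J_O(f_0+\delta f)=J_O(f_0)+\sum_{m=1}^{4}\frac1{(2m)!}J_O^{(2m)}(f_0)(\delta f,\dots,\delta f)+o(\|\delta f\|^9),$$ where 1. for every $f\in\mathfrak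 H^0\setminus\mathfrak H^1$, $J_O^{(2)}(f_0)(f,f)<0$; 2. for every $f\in\mathfrak H^1$, $J_O^{(2)}(f_0)(f,f)=0$ and $J_O^{(4)}(f_0)(f,\dots,f)=0$; 3. for every $f\in\mathfrak H^1\setminus\mathfrak H^3$, $J_O^{(6)}(f_0)(f,\dots,f)<0$; 4. for every $f\in\mathfrak H^3$, $J_O^{(6)}(f_0)(f,\dots,f)=0$ and $J_O^{(8)}(f_0)(f,\dots,f)=8!\,(\lambda_1-\lambda_3)\,|A^4_{13}\langle f\rangle|^2\ge0$. If moreover $|v_{12}|\ne|v_{23}|$ and $T\ge 2\pi/|\omega|$, then the control $$f(t)=\bigl(A+B\sin(2|\omega|t)+C\cos(3|\omega|t)\bigr)\chi_{[0,2\pi/|\omega|]}(t),\qquad A=1,\quad B=\frac{\sqrt{19-\sqrt{73}}}{\sqrt6},\quad C=\frac{5+\sqrt{73}}3,$$ belongs to $\mathfrak H^3$ and satisfies $J_O^{(8)}(f_0)(f,\dots,f)>0$; the zero control $f_0$ is not a point of global maximum of $J_O$, and $f_0$ is a trap of the seventh order for $J_O$. -/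

import Mathlib

open MeasureTheory Filter Topology Asymptotics

namespace ThreeLevel

noncomputable section

/-- The space of controls: the real Hilbert space `L₂([0,T], ℝ)`. -/
abbrev Control (T : ℝ) : Type := Lp ℝ 2 (volume.restrict (Set.Icc (0 : ℝ) T))

/-- The free Hamiltonian `diag(h₁, h₂, h₃)`. The levels 1, 2, 3 are the indices 0, 1, 2. -/
def freeHamiltonian (h : Fin 3 → ℝ) : Matrix (Fin 3) (Fin 3) ℂ :=
  Matrix.diagonal fun j => (h j : ℂ)

/-- The interaction Hamiltonian with forbidden transition between levels 1 and 3. -/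
def interactionHamiltonian (v₁₂ v₂₃ : ℂ) : Matrix (Fin 3) (Fin 3) ℂ :=
  !![0, v₁₂, 0;
     star v₁₂, 0, v₂₃;
     0, star v₂₃, 0]

/-- The initial density matrix `|3⟩⟨3|`. -/
def initialState : Matrix (Fin 3) (Fin 3) ℂ := Matrix.single 2 2 1

/-- The observable `O = diag(λ₁, λ₂, λ₃)`. -/
def observable (lam : Fin 3 → ℝ) : Matrix (Fin 3) (Fin 3) ℂ :=
  Matrix.diagonal fun j => (lam j : ℂ)

/-- `U` is an absolutely continuous solution on `[0,T]` of the Schrödinger equation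
`i dU/dt = (H₀ + f(t) V) U`, `U(0) = 1`; the equation holds for almost every `t ∈ [0,T]`. -/
structure IsEvolution (H₀ V : Matrix (Fin 3) (Fin 3) ℂ) (T : ℝ) (f : ℝ → ℝ)
    (U : ℝ → Matrix (Fin 3) (Fin 3) ℂ) : Prop where
  absolutelyContinuous : ∀ j k, AbsolutelyContinuousOnInterval (fun t => U t j k) 0 T
  initial : U 0 = 1
  equation : ∀ᵐ t ∂(volume.restrict (Set.Icc (0 : ℝ) T)), ∀ j k,
    HasDerivAt (fun s => U s j k)
      ((-Complex.I) * (((H₀ + (f t : ℂ) • V) * U t) j k)) t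

/-- The evolution operator `t ↦ U_t^f`: the solution of the Schrödinger equation. It exists and is
unique on `[0,T]` for every control, so the choice is harmless. -/
def evolution (H₀ V : Matrix (Fin 3) (Fin 3) ℂ) (T : ℝ) (f : Control T) :
    ℝ → Matrix (Fin 3) (Fin 3) ℂ :=
  Classical.epsilon (IsEvolution H₀ V T f)

/-- The objective functional `J_O(f) = Tr[U_T^f ρ₀ (U_T^f)† O]` (a real number, because `ρ₀` and
`O` are Hermitian). -/
def objective (H₀ V O : Matrix (Fin 3) (Fin 3) ℂ) (T : ℝ) (f : Control T) : ℝ :=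
  (Matrix.trace (evolution H₀ V T f T * initialState *
    (evolution H₀ V T f T).conjTranspose * O)).re

/-- The interaction picture `V_t = e^{itH₀} V e^{-itH₀}`. -/
def interactionPicture (H₀ V : Matrix (Fin 3) (Fin 3) ℂ) (t : ℝ) : Matrix (Fin 3) (Fin 3) ℂ :=
  NormedSpace.exp ((Complex.I * (t : ℂ)) • H₀) * V *
    NormedSpace.exp ((-(Complex.I * (t : ℂ))) • H₀)

/-- The matrix of iterated integrals
`∫₀ᵗ dt₁ ∫₀^{t₁} dt₂ … ∫₀^{tₙ₋₁} dtₙ f(t₁) ⋯ f(tₙ) V_{t₁} ⋯ V_{tₙ}`, by recursion on `n`. -/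
def dyson (H₀ V : Matrix (Fin 3) (Fin 3) ℂ) (f : ℝ → ℝ) :
    ℕ → ℝ → Matrix (Fin 3) (Fin 3) ℂ
  | 0, _ => 1
  | n + 1, t => Matrix.of fun l k =>
      ∫ s in (0 : ℝ)..t, (f s : ℂ) * (interactionPicture H₀ V s * dyson H₀ V f n s) l k

/-- The form `Aⁿ_{lk}⟨f⟩` of order `n` on `L₂([0,T], ℝ)`, with the levels 1, 2, 3 written as the
indices 0, 1, 2: `A¹₂₃` is `dysonForm H₀ V T 1 1 2`. -/
def dysonForm (H₀ V : Matrix (Fin 3) (Fin 3) ℂ) (T : ℝ) (n : ℕ) (l k : Fin 3)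
    (f : Control T) : ℂ :=
  dyson H₀ V f n T l k

/-- `𝔥¹ = {f : A¹₂₃⟨f⟩ = 0}`. -/
def spaceH1 (H₀ V : Matrix (Fin 3) (Fin 3) ℂ) (T : ℝ) : Set (Control T) :=
  {f | dysonForm H₀ V T 1 1 2 f = 0}

/-- `𝔥³ = {f ∈ 𝔥¹ : A³₂₃⟨f⟩ = 0}`. -/
def spaceH3 (H₀ V : Matrix (Fin 3) (Fin 3) ℂ) (T : ℝ) : Set (Control T) :=
  {f | f ∈ spaceH1 H₀ V T ∧ dysonForm H₀ V T 3 1 2 f = 0}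

/-- The `n`-th variation `J⁽ⁿ⁾(f)(g, …, g)`: the Fréchet differential of order `n` of `J` at `f`,
evaluated on the diagonal. -/
def variation {E : Type*} [NormedAddCommGroup E] [NormedSpace ℝ E] (J : E → ℝ) (n : ℕ)
    (f g : E) : ℝ :=
  iteratedFDeriv ℝ n J f fun _ => g

/-- The functional `R(g) = ∑_{j=2}^{n} J⁽ʲ⁾(f)(g, …, g) / j!`. -/
def taylorPart {E : Type*} [NormedAddCommGroup E] [NormedSpace ℝ E] (J : E → ℝ) (n : ℕ)
    (f g : E) : ℝ :=
  ∑ j ∈ Finset.Icc 2 n, variation J j f g / (j.factorial : ℝ)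

/-- `f` is a trap of `n`-th order for `J`. -/
structure IsTrapOfOrder {E : Type*} [NormedAddCommGroup E] [NormedSpace ℝ E] (J : E → ℝ)
    (n : ℕ) (f : E) : Prop where
  not_global_max : ¬ ∀ g, J g ≤ J f
  contDiffAt : ContDiffAt ℝ n J f
  taylor : (fun g => J (f + g) - (J f + taylorPart J n f g)) =o[𝓝 0] fun g => ‖g‖ ^ n
  ne_zero : ∃ g, taylorPart J n f g ≠ 0
  nonpos : ∀ g, ∃ ε : ℝ, 0 < ε ∧ ∀ t ∈ Set.Ioo (-ε) ε, taylorPart J n f (t • g) ≤ 0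

/-- The control `(A + B sin 2τ + C cos 3τ) χ_{[0,2π]}(τ)`, `τ = |ω| t`, with
`A = 1`, `B = √(19 - √73) / √6`, `C = (5 + √73) / 3`. -/
def specialControl (ω : ℝ) : ℝ → ℝ :=
  Set.indicator (Set.Icc 0 (2 * Real.pi / |ω|)) fun t =>
    1 + Real.sqrt (19 - Real.sqrt 73) / Real.sqrt 6 * Real.sin (2 * (|ω| * t))
      + (5 + Real.sqrt 73) / 3 * Real.cos (3 * (|ω| * t))

end

end ThreeLevel

open ThreeLevel

/-! In the interaction picture the state starting in level 3 solves `g = e + W_f g`, where `W_f` is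
a Volterra operator, bounded and linear in `f`. Near `f = 0` the solution is `(1 - W_f)⁻¹ e`, hence
analytic in `f`, and its geometric series is the Dyson series (`volterra_pow_apply`). Since the norm
is conserved, the population of level 3 can be eliminated, and `J` becomes λ₃ plus (λ₁ - λ₃) times
the population of level 1 minus (λ₃ - λ₂) times that of level 2 (`objective_eq`).

The interaction couples only neighbouring levels, so level 1 is reached at even orders and level 2
at odd orders. Squaring moduli along a line `t • g` gives the even expansion `objective_expansion`,
and uniqueness of Taylor coefficients turns it into formulas for the variations
(`variation_objective`).

In the harmonic case every Dyson term used is a polynomial in the amplitude `a(t) = ∫ f e^{-iωs}`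
and the moments `M_n = ∫ f e^{iωs} aⁿ`. In particular A²₁₃ is a multiple of `a(T)²`, while A¹₂₃ is a
multiple of `a(T)`. When `a(T) = 0`, all contributions of order 2 and 4 vanish, and order 6 is a
negative multiple of |A³₂₃|². If A³₂₃ vanishes too, order 8 is a positive multiple of |A⁴₁₃|². Thus
the Taylor part of order 7 is nonpositive near zero in each direction, while a direction with A⁴₁₃ ≠
0 in the last space makes `J` grow like `t⁸`.

When `a(T) = 0`, A³₂₃ is a multiple of `M₂` and A⁴₁₃ is `v₁₂ v₂₃ (|v₂₃|² - |v₁₂|²) M₃ / 2`. For the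
explicit control these moments are constant terms of Laurent polynomials in `e^{iτ}`: `M₂ = 0` and
`M₃ ≠ 0` (`special_moments`). -/

namespace ThreeLevel

noncomputable section

/-! ### Calculus of absolutely continuous functions. -/

/-- `F` is absolutely continuous on `[0,T]`, with derivative `F'` almost everywhere on `[0,T]`. -/
structure HasACDeriv (T : ℝ) (F F' : ℝ → ℂ) : Prop where
  ac : AbsolutelyContinuousOnInterval F 0 T
  deriv : ∀ᵐ t ∂(volume.restrict (Set.Icc (0 : ℝ) T)), HasDerivAt F (F' t) t

theorem absolutelyContinuousOnInterval_const (c : ℂ) (a b : ℝ) :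
    AbsolutelyContinuousOnInterval (fun _ => c) a b :=
  (contDiff_const (c := c) (n := 1)).contDiffOn.absolutelyContinuousOnInterval

theorem AbsolutelyContinuousOnInterval.ofReal {F : ℝ → ℝ} {a b : ℝ}
    (hF : AbsolutelyContinuousOnInterval F a b) :
    AbsolutelyContinuousOnInterval (fun t => (F t : ℂ)) a b := by
  simpa using hF.fun_smul (absolutelyContinuousOnInterval_const 1 a b)

namespace HasACDeriv

variable {T : ℝ} {F G F' G' : ℝ → ℂ}

theorem add (hF : HasACDeriv T F F') (hG : HasACDeriv T G G') :
    HasACDeriv T (fun t => F t + G t) (fun t => F' t + G' t) where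
  ac := hF.ac.fun_add hG.ac
  deriv := by filter_upwards [hF.deriv, hG.deriv] with t h₁ h₂ using h₁.add h₂

theorem sub (hF : HasACDeriv T F F') (hG : HasACDeriv T G G') :
    HasACDeriv T (fun t => F t - G t) (fun t => F' t - G' t) where
  ac := hF.ac.fun_sub hG.ac
  deriv := by filter_upwards [hF.deriv, hG.deriv] with t h₁ h₂ using h₁.sub h₂

theorem mul (hF : HasACDeriv T F F') (hG : HasACDeriv T G G') :
    HasACDeriv T (fun t => F t * G t) (fun t => F' t * G t + F t * G' t) where
  ac := hF.ac.fun_smul hG.ac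
  deriv := by filter_upwards [hF.deriv, hG.deriv] with t h₁ h₂ using h₁.mul h₂

theorem const (T : ℝ) (c : ℂ) : HasACDeriv T (fun _ => c) (fun _ => 0) where
  ac := absolutelyContinuousOnInterval_const c 0 T
  deriv := .of_forall fun t => hasDerivAt_const t c

theorem const_mul (c : ℂ) (hF : HasACDeriv T F F') :
    HasACDeriv T (fun t => c * F t) (fun t => c * F' t) where
  ac := hF.ac.const_smul c
  deriv := by filter_upwards [hF.deriv] with t h₁ using h₁.const_mul c

theorem congr_deriv (hF : HasACDeriv T F F')
    (h : ∀ᵐ t ∂(volume.restrict (Set.Icc (0 : ℝ) T)), F' t = G' t) : HasACDeriv T F G' where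
  ac := hF.ac
  deriv := by filter_upwards [hF.deriv, h] with t h₁ h₂ using h₂ ▸ h₁

theorem star (hF : HasACDeriv T F F') :
    HasACDeriv T (fun t => star (F t)) (fun t => star (F' t)) where
  ac := by
    have := hF.ac
    rw [absolutelyContinuousOnInterval_iff] at this ⊢
    simpa only [dist_star_star] using this
  deriv := by filter_upwards [hF.deriv] with t h₁ using h₁.star

theorem of_hasDerivAt (h : ∀ t, HasDerivAt F (F' t) t) (hF' : Continuous F') :
    HasACDeriv T F F' where
  ac := by
    refine (contDiff_one_iff_deriv.2 ⟨fun t => (h t).differentiableAt, ?_⟩).contDiffOn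
      |>.absolutelyContinuousOnInterval
    rwa [show _root_.deriv F = F' from funext fun t => (h t).deriv]
  deriv := .of_forall h

theorem eq_of_deriv_zero (hT : 0 ≤ T) (hF : HasACDeriv T F fun _ => 0) {t : ℝ}
    (ht : t ∈ Set.Icc 0 T) : F t = F 0 := by
  have h := (ae_restrict_iff' measurableSet_Icc).1 hF.deriv
  obtain ⟨C, hC⟩ := hF.ac.const_of_ae_hasDerivAt_zero (by simpa [Set.uIcc_of_le hT] using h)
  rw [Set.uIcc_of_le hT] at hC
  rw [hC t ht, hC 0 ⟨le_rfl, hT⟩]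

theorem integral {u : ℝ → ℂ} (hT : 0 ≤ T) (hu : IntegrableOn u (Set.Icc 0 T)) :
    HasACDeriv T (fun t => ∫ s in (0 : ℝ)..t, u s) u := by
  have hi : IntervalIntegrable u volume 0 T :=
    (intervalIntegrable_iff_integrableOn_Icc_of_le hT).2 hu
  have hre : IntervalIntegrable (fun s => (u s).re) volume 0 T :=
    (intervalIntegrable_iff_integrableOn_Icc_of_le hT).2 hu.re
  have him : IntervalIntegrable (fun s => (u s).im) volume 0 T :=
    (intervalIntegrable_iff_integrableOn_Icc_of_le hT).2 hu.im
  refine ⟨?_, ?_⟩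
  · have h₁ := AbsolutelyContinuousOnInterval.ofReal
      (hre.absolutelyContinuousOnInterval_intervalIntegral (c := 0) (by simp))
    have h₂ := AbsolutelyContinuousOnInterval.ofReal
      (him.absolutelyContinuousOnInterval_intervalIntegral (c := 0) (by simp))
    have h₃ := h₁.fun_add (h₂.const_smul Complex.I)
    rw [absolutelyContinuousOnInterval_iff] at h₃ ⊢
    have key : ∀ t ∈ Set.Icc 0 T, ((∫ s in (0 : ℝ)..t, (u s).re : ℝ) : ℂ)
        + Complex.I • ((∫ s in (0 : ℝ)..t, (u s).im : ℝ) : ℂ) = ∫ s in (0 : ℝ)..t, u s := by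
      intro t ht
      have hit : IntervalIntegrable u volume 0 t := hi.mono_set (by
        rw [Set.uIcc_of_le hT, Set.uIcc_of_le ht.1]; exact Set.Icc_subset_Icc_right ht.2)
      have e₁ := Complex.reCLM.intervalIntegral_comp_comm hit
      have e₂ := Complex.imCLM.intervalIntegral_comp_comm hit
      simp only [Complex.reCLM_apply, Complex.imCLM_apply] at e₁ e₂
      rw [e₁, e₂, smul_eq_mul, mul_comm, Complex.re_add_im]
    intro ε hε
    obtain ⟨δ, hδ, H⟩ := h₃ ε hε
    refine ⟨δ, hδ, fun E hE hl => ?_⟩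
    refine lt_of_eq_of_lt (Finset.sum_congr rfl fun i hi => ?_) (H E hE hl)
    have := hE.1 i hi
    rw [Set.uIcc_of_le hT] at this
    rw [key _ this.1, key _ this.2]
  · have := hi.ae_hasDerivAt_integral
    rw [ae_restrict_iff' measurableSet_Icc]
    filter_upwards [this] with t ht htT
    exact ht (by rwa [Set.uIcc_of_le hT]) 0 (by simp)

theorem eq_integral {u : ℝ → ℂ} (hT : 0 ≤ T) (hF : HasACDeriv T F u)
    (hu : IntegrableOn u (Set.Icc 0 T)) {t : ℝ} (ht : t ∈ Set.Icc 0 T) :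
    F t = F 0 + ∫ s in (0 : ℝ)..t, u s := by
  have := (hF.sub (integral hT hu)).congr_deriv (G' := fun _ => 0) (.of_forall fun t => by simp)
  have := this.eq_of_deriv_zero hT ht
  simp only [intervalIntegral.integral_same, sub_zero] at this
  rw [← this]; ring

theorem continuousOn (hT : 0 ≤ T) (hF : HasACDeriv T F F') : ContinuousOn F (Set.Icc 0 T) := by
  simpa [Set.uIcc_of_le hT] using hF.ac.continuousOn

end HasACDeriv

/-! ### The interaction picture in coordinates. -/

theorem interactionPicture_apply (h : Fin 3 → ℝ) (V : Matrix (Fin 3) (Fin 3) ℂ) (t : ℝ)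
    (j k : Fin 3) :
    interactionPicture (freeHamiltonian h) V t j k
      = Complex.exp (Complex.I * (h j - h k) * t) * V j k := by
  have hexp : ∀ z : ℂ, NormedSpace.exp (z • freeHamiltonian h)
      = Matrix.diagonal fun j => Complex.exp (z * h j) := by
    intro z
    rw [freeHamiltonian, ← Matrix.diagonal_smul, Matrix.exp_diagonal]
    congr 1
    funext j
    rw [Pi.coe_exp, ← Complex.exp_eq_exp_ℂ]
    simp
  rw [interactionPicture, hexp, hexp, Matrix.mul_diagonal, Matrix.diagonal_mul,
    mul_right_comm, ← Complex.exp_add]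
  congr 2
  ring

theorem continuous_interactionPicture_apply (h : Fin 3 → ℝ) (V : Matrix (Fin 3) (Fin 3) ℂ)
    (j k : Fin 3) : Continuous fun t => interactionPicture (freeHamiltonian h) V t j k := by
  simp only [interactionPicture_apply]
  fun_prop

theorem norm_interactionPicture_apply (h : Fin 3 → ℝ) (V : Matrix (Fin 3) (Fin 3) ℂ) (t : ℝ)
    (j k : Fin 3) : ‖interactionPicture (freeHamiltonian h) V t j k‖ = ‖V j k‖ := by
  rw [interactionPicture_apply, norm_mul, mul_assoc, ← Complex.ofReal_sub, ← Complex.ofReal_mul,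
    mul_comm Complex.I, Complex.norm_exp_ofReal_mul_I, one_mul]

/-! ### The Volterra operator and the Dyson series. -/

/-- The space of continuous vector-valued functions on `[0,T]`. -/
abbrev Path (T : ℝ) : Type := C(Set.Icc (0 : ℝ) T, Fin 3 → ℂ)

theorem integrableOn_control {T : ℝ} (f : Control T) : IntegrableOn f (Set.Icc 0 T) :=
  (Lp.memLp f).integrable one_le_two

theorem integrableOn_control_mul {T : ℝ} (f : Control T) {u : ℝ → ℂ}
    (hu : ContinuousOn u (Set.Icc 0 T)) :
    IntegrableOn (fun s => (f s : ℂ) * u s) (Set.Icc 0 T) :=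
  IntegrableOn.mul_continuousOn (integrableOn_control f).ofReal hu isCompact_Icc

/-- Hölder's inequality on an interval of finite measure. It makes the Volterra operator bounded in
the `L₂` norm of the control. -/
theorem integral_norm_control_le (T : ℝ) :
    ∃ C, 0 ≤ C ∧ ∀ f : Control T, ∫ s in Set.Icc 0 T, ‖f s‖ ≤ C * ‖f‖ := by
  refine ⟨(volume.restrict (Set.Icc (0 : ℝ) T) Set.univ ^ (1 / (1 : ENNReal).toReal
    - 1 / (2 : ENNReal).toReal)).toReal, ENNReal.toReal_nonneg, fun f => ?_⟩
  have hfin : volume.restrict (Set.Icc (0 : ℝ) T) Set.univ ^ (1 / (1 : ENNReal).toReal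
      - 1 / (2 : ENNReal).toReal) ≠ ⊤ := by
    apply ENNReal.rpow_ne_top_of_nonneg (by norm_num) (measure_ne_top _ _)
  have h := eLpNorm_le_eLpNorm_mul_rpow_measure_univ (μ := volume.restrict (Set.Icc (0 : ℝ) T))
    one_le_two (Lp.aestronglyMeasurable f)
  rw [integral_norm_eq_lintegral_enorm (Lp.aestronglyMeasurable f), ← eLpNorm_one_eq_lintegral_enorm,
    Lp.norm_def, ← ENNReal.toReal_mul, mul_comm]
  exact ENNReal.toReal_mono (ENNReal.mul_ne_top (Lp.eLpNorm_ne_top f) hfin) h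

/-- The integrand `-i V_s g(s)` extended to the real line. -/
def drift (h : Fin 3 → ℝ) (V : Matrix (Fin 3) (Fin 3) ℂ) {T : ℝ} (hT : 0 ≤ T) (g : Path T)
    (j : Fin 3) (s : ℝ) : ℂ :=
  -Complex.I * (interactionPicture (freeHamiltonian h) V s).mulVec (g (Set.projIcc 0 T hT s)) j

section

variable (h : Fin 3 → ℝ) (V : Matrix (Fin 3) (Fin 3) ℂ) {T : ℝ} (hT : 0 ≤ T)

theorem continuous_drift (g : Path T) (j : Fin 3) : Continuous (drift h V hT g j) := by
  unfold drift Matrix.mulVec dotProduct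
  have := continuous_interactionPicture_apply h V j
  have := continuous_projIcc (a := 0) (b := T) (h := hT)
  fun_prop

theorem norm_drift_le (g : Path T) (j : Fin 3) (s : ℝ) :
    ‖drift h V hT g j s‖ ≤ (∑ j, ∑ l, ‖V j l‖) * ‖g‖ := by
  rw [drift, norm_mul, norm_neg, Complex.norm_I, one_mul, Matrix.mulVec, dotProduct]
  calc _ ≤ ∑ l, ‖V j l‖ * ‖g‖ := by
        refine norm_sum_le_of_le _ fun l _ => ?_
        rw [norm_mul, norm_interactionPicture_apply]
        gcongr
        exact (norm_le_pi_norm _ l).trans (g.norm_coe_le_norm _)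
    _ = (fun j => ∑ l, ‖V j l‖) j * ‖g‖ := (Finset.sum_mul _ _ _).symm
    _ ≤ _ := by
        gcongr
        exact Finset.single_le_sum (f := fun j => ∑ l, ‖V j l‖)
          (fun i _ => by positivity) (Finset.mem_univ j)

theorem drift_add (g₁ g₂ : Path T) (j : Fin 3) (s : ℝ) :
    drift h V hT (g₁ + g₂) j s = drift h V hT g₁ j s + drift h V hT g₂ j s := by
  simp [drift, Matrix.mulVec_add, mul_add]

theorem drift_smul (c : ℝ) (g : Path T) (j : Fin 3) (s : ℝ) :
    drift h V hT (c • g) j s = c * drift h V hT g j s := by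
  simp only [drift, ContinuousMap.coe_smul, Pi.smul_apply, Matrix.mulVec_smul,
    Complex.real_smul]
  ring

/-- The function `t ↦ ∫₀ᵗ f(s) (-i V_s g(s)) ds`. -/
def primitive (f : Control T) (g : Path T) (j : Fin 3) (t : ℝ) : ℂ :=
  ∫ s in (0 : ℝ)..t, (f s : ℂ) * drift h V hT g j s

theorem integrableOn_primitive (f : Control T) (g : Path T) (j : Fin 3) :
    IntegrableOn (fun s => (f s : ℂ) * drift h V hT g j s) (Set.Icc 0 T) :=
  integrableOn_control_mul f (continuous_drift h V hT g j).continuousOn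

theorem hasACDeriv_primitive (f : Control T) (g : Path T) (j : Fin 3) :
    HasACDeriv T (primitive h V hT f g j) fun s => (f s : ℂ) * drift h V hT g j s :=
  HasACDeriv.integral hT (integrableOn_primitive h V hT f g j)

theorem intervalIntegrable_primitive (f : Control T) (g : Path T) (j : Fin 3) {t : ℝ}
    (ht : t ∈ Set.Icc 0 T) :
    IntervalIntegrable (fun s => (f s : ℂ) * drift h V hT g j s) volume 0 t :=
  (intervalIntegrable_iff_integrableOn_Icc_of_le ht.1).2
    ((integrableOn_primitive h V hT f g j).mono_set (Set.Icc_subset_Icc_right ht.2))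

theorem intervalIntegral_congr_of_ae_restrict {u v : ℝ → ℂ}
    (huv : ∀ᵐ s ∂(volume.restrict (Set.Icc (0 : ℝ) T)), u s = v s) {t : ℝ}
    (ht : t ∈ Set.Icc 0 T) : ∫ s in (0 : ℝ)..t, u s = ∫ s in (0 : ℝ)..t, v s := by
  refine intervalIntegral.integral_congr_ae ?_
  filter_upwards [(ae_restrict_iff' measurableSet_Icc).1 huv] with s hs hst
  rw [Set.uIoc_of_le ht.1] at hst
  exact hs ⟨hst.1.le, hst.2.trans ht.2⟩

theorem norm_primitive_le (f : Control T) (g : Path T) (j : Fin 3) {t : ℝ}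
    (ht : t ∈ Set.Icc 0 T) :
    ‖primitive h V hT f g j t‖
      ≤ (∫ s in Set.Icc 0 T, ‖f s‖) * ((∑ j, ∑ l, ‖V j l‖) * ‖g‖) := by
  have hf := integrableOn_control f
  refine (intervalIntegral.norm_integral_le_integral_norm ht.1).trans ?_
  rw [intervalIntegral.integral_of_le ht.1, ← integral_Icc_eq_integral_Ioc]
  have h₁ := (integrableOn_primitive h V hT f g j).norm
  calc _ ≤ ∫ s in Set.Icc 0 T, ‖(f s : ℂ) * drift h V hT g j s‖ :=
        setIntegral_mono_set h₁ (.of_forall fun s => norm_nonneg _)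
          (Set.Icc_subset_Icc_right ht.2).eventuallyLE
    _ ≤ ∫ s in Set.Icc 0 T, ‖f s‖ * ((∑ j, ∑ l, ‖V j l‖) * ‖g‖) := by
        refine integral_mono h₁ (hf.norm.mul_const _) fun s => ?_
        simp only [norm_mul, Complex.norm_real]
        gcongr
        exact norm_drift_le h V hT g j s
    _ = _ := integral_mul_const _ _

/-- The bilinear operator `(f, g) ↦ (t ↦ ∫₀ᵗ f(s) (-i V_s g(s)) ds)`. -/
def volterraLinear : Control T →ₗ[ℝ] Path T →ₗ[ℝ] Path T :=
  LinearMap.mk₂ ℝ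
    (fun f g => ⟨fun t j => primitive h V hT f g j t, by
      refine continuous_pi fun j => ?_
      exact ((hasACDeriv_primitive h V hT f g j).continuousOn hT).domRestrict⟩)
    (by
      intro f₁ f₂ g
      ext t j
      simp only [ContinuousMap.coe_mk, ContinuousMap.add_apply, Pi.add_apply, primitive]
      rw [← intervalIntegral.integral_add (intervalIntegrable_primitive h V hT f₁ g j t.2)
        (intervalIntegrable_primitive h V hT f₂ g j t.2)]
      refine intervalIntegral_congr_of_ae_restrict ?_ t.2
      filter_upwards [Lp.coeFn_add f₁ f₂] with s hs
      rw [hs, Pi.add_apply, Complex.ofReal_add, add_mul])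
    (by
      intro c f g
      ext t j
      simp only [ContinuousMap.coe_mk, ContinuousMap.smul_apply, Pi.smul_apply, primitive,
        Complex.real_smul]
      rw [← intervalIntegral.integral_const_mul]
      refine intervalIntegral_congr_of_ae_restrict ?_ t.2
      filter_upwards [Lp.coeFn_smul c f] with s hs
      rw [hs, Pi.smul_apply, smul_eq_mul, Complex.ofReal_mul, mul_assoc])
    (by
      intro f g₁ g₂
      ext t j
      simp only [ContinuousMap.coe_mk, ContinuousMap.add_apply, Pi.add_apply, primitive]
      rw [← intervalIntegral.integral_add (intervalIntegrable_primitive h V hT f g₁ j t.2)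
        (intervalIntegrable_primitive h V hT f g₂ j t.2)]
      simp only [drift_add, mul_add])
    (by
      intro c f g
      ext t j
      simp only [ContinuousMap.coe_mk, ContinuousMap.smul_apply, Pi.smul_apply, primitive,
        Complex.real_smul]
      rw [← intervalIntegral.integral_const_mul]
      simp only [drift_smul, mul_left_comm])

/-- The Volterra operator `g ↦ (t ↦ ∫₀ᵗ f(s) (-i V_s g(s)) ds)`, as a continuous linear function
of the control `f`. -/
def volterra : Control T →L[ℝ] Path T →L[ℝ] Path T :=
  LinearMap.mkContinuous₂ (volterraLinear h V hT)
    ((integral_norm_control_le T).choose * ∑ j, ∑ l, ‖V j l‖) (by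
      intro f g
      obtain ⟨hC, hC'⟩ := (integral_norm_control_le T).choose_spec
      have hS : (0 : ℝ) ≤ ∑ j, ∑ l, ‖V j l‖ := by positivity
      rw [ContinuousMap.norm_le _ (by positivity)]
      intro t
      rw [pi_norm_le_iff_of_nonneg (by positivity)]
      intro j
      refine (norm_primitive_le h V hT f g j t.2).trans ?_
      calc _ ≤ ((integral_norm_control_le T).choose * ‖f‖) * ((∑ j, ∑ l, ‖V j l‖) * ‖g‖) := by
            gcongr
            exact hC' f
        _ = _ := by ring)

theorem volterra_apply (f : Control T) (g : Path T) (t : Set.Icc (0 : ℝ) T) (j : Fin 3) :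
    volterra h V hT f g t j = primitive h V hT f g j t := rfl

/-- The constant path at the basis vector `|k⟩`. -/
def basisPath (T : ℝ) (k : Fin 3) : Path T := ContinuousMap.const _ (Pi.single k 1)

/-- Each application of the operator adds one outer integration and one factor `-i`, which is the
recursion defining `dyson`. -/
theorem volterra_pow_apply (f : Control T) (n : ℕ) (t : Set.Icc (0 : ℝ) T) (j k : Fin 3) :
    (volterra h V hT f ^ n) (basisPath T k) t j
      = (-Complex.I) ^ n * dyson (freeHamiltonian h) V f n t j k := by
  induction n generalizing t j with
  | zero => simp [dyson, basisPath, Matrix.one_apply, Pi.single_apply]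
  | succ n ih =>
    rw [pow_succ', mul_apply_eq_comp, volterra_apply, primitive, dyson, Matrix.of_apply,
      ← intervalIntegral.integral_const_mul]
    refine intervalIntegral_congr_of_ae_restrict ?_ t.2
    rw [ae_restrict_iff' measurableSet_Icc]
    refine .of_forall fun s hs => ?_
    simp only [drift, Matrix.mulVec, dotProduct, Set.projIcc_of_mem hT hs, Matrix.mul_apply, ih]
    simp only [Finset.mul_sum]
    refine Finset.sum_congr rfl fun l _ => ?_
    ring

end

/-! ### The evolution operator and the objective as functions of the resolvent. -/

section

variable (h : Fin 3 → ℝ) (V : Matrix (Fin 3) (Fin 3) ℂ) {T : ℝ} (hT : 0 ≤ T)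

/-- The solution of the integral equation `g(t) = |k⟩ + ∫₀ᵗ f(s) (-i V_s g(s)) ds`. -/
def solution (f : Control T) (k : Fin 3) : Path T :=
  Ring.inverse (1 - volterra h V hT f) (basisPath T k)

variable {h V hT}

/-- `Ring.inverse` is zero at non-units, so invertibility has to be assumed. It holds for small
controls, and everything below takes place near the zero control. -/
theorem solution_eq {f : Control T} (hf : IsUnit (1 - volterra h V hT f)) (k : Fin 3) :
    solution h V hT f k = basisPath T k + volterra h V hT f (solution h V hT f k) := by
  have := congrArg (fun A : Path T →L[ℝ] Path T => A (basisPath T k)) (Ring.mul_inverse_cancel _ hf)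
  simp only [mul_apply_eq_comp, sub_apply, one_apply_eq_self] at this
  rw [← this]
  simp [solution]

theorem eq_solution {f : Control T} (hf : IsUnit (1 - volterra h V hT f)) {k : Fin 3} {g : Path T}
    (hg : g = basisPath T k + volterra h V hT f g) : g = solution h V hT f k := by
  have := congrArg (fun A : Path T →L[ℝ] Path T => A g) (Ring.inverse_mul_cancel _ hf)
  simp only [mul_apply_eq_comp, sub_apply, one_apply_eq_self] at this
  rw [solution, ← this]
  congr 1
  exact sub_eq_of_eq_add hg

theorem schrodinger_apply (h : Fin 3 → ℝ) (V U : Matrix (Fin 3) (Fin 3) ℂ) (c : ℂ)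
    (j k : Fin 3) : ((freeHamiltonian h + c • V) * U) j k
      = h j * U j k + c * ∑ l, V j l * U l k := by
  rw [Matrix.add_mul, Matrix.add_apply, freeHamiltonian, Matrix.diagonal_mul, Matrix.smul_mul,
    Matrix.smul_apply, Matrix.mul_apply, smul_eq_mul]

theorem hasACDeriv_exp (c : ℂ) (T : ℝ) :
    HasACDeriv T (fun t => Complex.exp (c * t)) fun t => c * Complex.exp (c * t) := by
  refine HasACDeriv.of_hasDerivAt (fun t => ?_) (by fun_prop)
  have h₁ : HasDerivAt (fun t : ℝ => c * (t : ℂ)) (c * 1) t :=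
    (Complex.ofRealCLM.hasDerivAt (x := t)).const_mul c
  have := h₁.cexp
  rwa [mul_one, mul_comm] at this

/-- Multiplying by `e^{-i h_j t}` undoes the interaction picture. The witness contains `primitive`
rather than the path itself because a path lives only on `[0,T]`, while the derivative is taken on
the real line. -/
theorem exists_isEvolution {f : Control T} (hf : IsUnit (1 - volterra h V hT f)) :
    ∃ U, IsEvolution (freeHamiltonian h) V T f U := by
  have hac : ∀ j k, HasACDeriv T (fun t : ℝ => Complex.exp (-Complex.I * h j * t)
      * ((1 : Matrix (Fin 3) (Fin 3) ℂ) j k + primitive h V hT f (solution h V hT f k) j t)) _ :=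
    fun j k => (hasACDeriv_exp _ T).mul
      ((HasACDeriv.const T _).add (hasACDeriv_primitive h V hT f (solution h V hT f k) j))
  refine ⟨fun t => Matrix.of fun j k => Complex.exp (-Complex.I * h j * t)
      * ((1 : Matrix (Fin 3) (Fin 3) ℂ) j k + primitive h V hT f (solution h V hT f k) j t),
    fun j k => (hac j k).ac, ?_, ?_⟩
  · ext j k
    simp [primitive]
  · have := fun j k => (hac j k).deriv
    simp only [← ae_all_iff] at this
    filter_upwards [this, ae_restrict_mem measurableSet_Icc] with t ht htT j k
    refine (ht j k).congr_deriv ?_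
    have hsol : ∀ l, (1 : Matrix (Fin 3) (Fin 3) ℂ) l k
        + primitive h V hT f (solution h V hT f k) l t = solution h V hT f k ⟨t, htT⟩ l := by
      intro l
      conv_rhs => rw [solution_eq hf k]
      simp [volterra_apply, basisPath, Matrix.one_apply, Pi.single_apply]
    rw [schrodinger_apply]
    simp only [Matrix.of_apply, hsol]
    simp only [drift, Set.projIcc_of_mem hT htT, Matrix.mulVec, dotProduct,
      interactionPicture_apply, zero_add, mul_add, Finset.mul_sum]
    congr 1
    · ring
    · refine Finset.sum_congr rfl fun l _ => ?_
      have : Complex.exp (Complex.I * (h j - h l) * t)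
          = Complex.exp (-(-Complex.I * h j * t)) * Complex.exp (-Complex.I * h l * t) := by
        rw [← Complex.exp_add]; congr 1; ring
      rw [this, Complex.exp_neg]
      have := Complex.exp_ne_zero (-Complex.I * h j * t)
      field_simp

theorem IsEvolution.hasACDeriv {f : ℝ → ℝ} {U : ℝ → Matrix (Fin 3) (Fin 3) ℂ}
    (hU : IsEvolution (freeHamiltonian h) V T f U) (j k : Fin 3) :
    HasACDeriv T (fun t => U t j k)
      fun t => -Complex.I * (h j * U t j k + f t * ∑ l, V j l * U t l k) where
  ac := hU.absolutelyContinuous j k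
  deriv := by
    filter_upwards [hU.equation] with t ht
    rw [← schrodinger_apply]
    exact ht j k

/-- The phase `e^{i h_j t}` cancels the free part of the equation, leaving the Volterra equation,
whose solution is unique. Hence the choice made in `evolution` does not matter. -/
theorem IsEvolution.eq_solution {f : Control T} (hf : IsUnit (1 - volterra h V hT f))
    {U : ℝ → Matrix (Fin 3) (Fin 3) ℂ} (hU : IsEvolution (freeHamiltonian h) V T f U)
    (j k : Fin 3) (t : Set.Icc (0 : ℝ) T) :
    Complex.exp (Complex.I * h j * t) * U t j k = solution h V hT f k t j := by
  have hac := fun j => (hasACDeriv_exp (Complex.I * h j) T).mul (hU.hasACDeriv j k)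
  let g : Path T := ⟨fun t j => Complex.exp (Complex.I * h j * t) * U t j k,
    continuous_pi fun j => ((hac j).continuousOn hT).domRestrict⟩
  suffices hg : g = basisPath T k + volterra h V hT f g by
    exact congrArg (fun g : Path T => g t j) (ThreeLevel.eq_solution hf hg)
  ext t j
  have h₁ : HasACDeriv T _ fun s => (f s : ℂ) * drift h V hT g j s := (hac j).congr_deriv (by
    rw [ae_restrict_iff' measurableSet_Icc]
    refine .of_forall fun s hs => ?_
    simp only [drift, Set.projIcc_of_mem hT hs, Matrix.mulVec, dotProduct,
      interactionPicture_apply, mul_add, Finset.mul_sum, g, ContinuousMap.coe_mk]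
    rw [← add_assoc]
    refine (add_eq_right.2 (by ring)).trans (Finset.sum_congr rfl fun l _ => ?_)
    have : Complex.exp (Complex.I * (h j - h l) * s)
        = Complex.exp (Complex.I * h j * s) * Complex.exp (-(Complex.I * h l * s)) := by
      rw [← Complex.exp_add]; congr 1; ring
    rw [this, Complex.exp_neg]
    have := Complex.exp_ne_zero (Complex.I * h l * s)
    field_simp)
  have h₂ := h₁.eq_integral hT (integrableOn_primitive h V hT f g j) t.2
  simp only [hU.initial, Complex.ofReal_zero, mul_zero, Complex.exp_zero, one_mul] at h₂
  change _ = basisPath T k t j + primitive h V hT f g j t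
  rw [primitive, ← show (1 : Matrix (Fin 3) (Fin 3) ℂ) j k = basisPath T k t j by
    simp [basisPath, Matrix.one_apply, Pi.single_apply]]
  exact h₂

/-- The derivative of the squared norm of a column vanishes almost everywhere because the
Hamiltonian is Hermitian. -/
theorem IsEvolution.sum_norm_sq (hT : 0 ≤ T) (hV : V.IsHermitian) {f : ℝ → ℝ}
    {U : ℝ → Matrix (Fin 3) (Fin 3) ℂ} (hU : IsEvolution (freeHamiltonian h) V T f U)
    (k : Fin 3) : ‖U T 0 k‖ ^ 2 + ‖U T 1 k‖ ^ 2 + ‖U T 2 k‖ ^ 2 = 1 := by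
  have hac := fun j => (hU.hasACDeriv j k).star.mul (hU.hasACDeriv j k)
  have h₀ := (((hac 0).add (hac 1)).add (hac 2)).congr_deriv (G' := fun _ => 0) (.of_forall
    fun t => by
      have e : ∀ i j, V i j = star (V j i) := fun i j => (hV.apply i j).symm
      have d : ∀ i, star (V i i) = V i i := fun i => hV.apply i i
      simp only [Fin.sum_univ_three, star_mul', star_add, star_neg, Complex.star_def,
        Complex.conj_I, Complex.conj_ofReal] at d ⊢
      simp only [d, e 1 0, e 2 0, e 2 1, Complex.star_def, Complex.conj_conj]
      ring)
  have h₁ := h₀.eq_of_deriv_zero hT (t := T) ⟨hT, le_rfl⟩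
  rw [hU.initial] at h₁
  simp only [Complex.star_def, ← Complex.normSq_eq_conj_mul_self, ← Complex.ofReal_add,
    Complex.ofReal_inj, Complex.normSq_eq_norm_sq] at h₁
  rw [h₁]
  fin_cases k <;> simp [Matrix.one_apply]

/-- Phases do not affect moduli, and conservation of the norm removes the population of level 3. The
two remaining populations enter with opposite signs. -/
theorem objective_eq {f : Control T} (hf : IsUnit (1 - volterra h V hT f)) (hV : V.IsHermitian)
    (lam : Fin 3 → ℝ) : objective (freeHamiltonian h) V (observable lam) T f
      = lam 2 + (lam 0 - lam 2) * ‖solution h V hT f 2 ⟨T, hT, le_rfl⟩ 0‖ ^ 2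
        - (lam 2 - lam 1) * ‖solution h V hT f 2 ⟨T, hT, le_rfl⟩ 1‖ ^ 2 := by
  have hU : IsEvolution (freeHamiltonian h) V T f (evolution (freeHamiltonian h) V T f) :=
    Classical.epsilon_spec (exists_isEvolution hf)
  have hnorm : ∀ j, ‖solution h V hT f 2 ⟨T, hT, le_rfl⟩ j‖
      = ‖evolution (freeHamiltonian h) V T f T j 2‖ := by
    intro j
    rw [← hU.eq_solution hf j 2, norm_mul, mul_assoc, ← Complex.ofReal_mul, mul_comm Complex.I,
      Complex.norm_exp_ofReal_mul_I, one_mul]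
  have hs := hU.sum_norm_sq hT hV 2
  have htr : objective (freeHamiltonian h) V (observable lam) T f
      = ∑ j, lam j * ‖evolution (freeHamiltonian h) V T f T j 2‖ ^ 2 := by
    simp only [objective, observable, initialState, Matrix.trace, Matrix.diag,
      Matrix.mul_diagonal, Complex.re_sum]
    refine Finset.sum_congr rfl fun j _ => ?_
    rw [Matrix.mul_apply, Finset.sum_eq_single 2 (by
      intro b _ hb
      rw [Matrix.mul_single_apply_of_ne _ _ _ _ _ hb, zero_mul]) (by simp)]
    rw [Matrix.mul_single_apply_same, mul_one, Matrix.conjTranspose_apply, Complex.star_def,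
      Complex.mul_conj, ← Complex.ofReal_mul, Complex.ofReal_re, Complex.normSq_eq_norm_sq,
      mul_comm]
  rw [htr, Fin.sum_univ_three, hnorm, hnorm]
  linear_combination (lam 2) * hs

end

/-! ### Uniqueness of Taylor coefficients along lines, and analyticity of a resolvent. -/

section

/-- Letting `t → 0` kills the constant coefficient; dividing by `t` lowers the degree and the order
by one. -/
theorem eq_zero_of_sum_pow_isBigO {N : ℕ} {c : ℕ → ℝ}
    (hc : (fun t : ℝ => ∑ n ∈ Finset.range N, c n * t ^ n) =O[𝓝 0] fun t => t ^ N) :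
    ∀ n < N, c n = 0 := by
  induction N generalizing c with
  | zero => simp
  | succ N ih =>
    have h₀ : c 0 = 0 := by
      have h₁ : Tendsto (fun t : ℝ => ∑ n ∈ Finset.range (N + 1), c n * t ^ n) (𝓝 0) (𝓝 0) := by
        refine hc.trans_tendsto ?_
        have : Continuous fun t : ℝ => t ^ (N + 1) := by fun_prop
        simpa using this.tendsto 0
      have h₂ : Continuous fun t : ℝ => ∑ n ∈ Finset.range (N + 1), c n * t ^ n := by fun_prop
      have h₃ := tendsto_nhds_unique (h₂.tendsto 0) h₁
      rw [Finset.sum_range_succ'] at h₃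
      simpa using h₃
    have h₁ : (fun t : ℝ => ∑ n ∈ Finset.range N, c (n + 1) * t ^ n) =O[𝓝 0] fun t => t ^ N := by
      obtain ⟨C, hC⟩ := hc.bound
      have hne : (fun t : ℝ => ∑ n ∈ Finset.range N, c (n + 1) * t ^ n) =O[𝓝[≠] 0]
          fun t => t ^ N := by
        refine IsBigO.of_bound C ?_
        filter_upwards [hC.filter_mono nhdsWithin_le_nhds, self_mem_nhdsWithin] with t ht ht0
        have ht0 : 0 < ‖t‖ := norm_pos_iff.2 ht0
        rw [Finset.sum_range_succ', h₀] at ht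
        have e : ∑ n ∈ Finset.range N, c (n + 1) * t ^ (n + 1) + 0 * t ^ 0
            = t * ∑ n ∈ Finset.range N, c (n + 1) * t ^ n := by
          rw [Finset.mul_sum, zero_mul, add_zero]
          exact Finset.sum_congr rfl fun n _ => by ring
        rw [e, norm_mul, pow_succ', norm_mul, mul_left_comm] at ht
        exact le_of_mul_le_mul_left ht ht0
      -- Division by `t` leaves out the point zero, where the bound is recovered by continuity.
      obtain ⟨C, hC⟩ := hne.bound
      refine IsBigO.of_bound C ?_
      have h₁ : Continuous fun t : ℝ => ‖∑ n ∈ Finset.range N, c (n + 1) * t ^ n‖ := by fun_prop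
      have h₂ : Continuous fun t : ℝ => C * ‖t ^ N‖ := by fun_prop
      have h₀' := le_of_tendsto_of_tendsto ((h₁.tendsto 0).mono_left nhdsWithin_le_nhds)
        ((h₂.tendsto 0).mono_left nhdsWithin_le_nhds) hC
      filter_upwards [eventually_nhdsWithin_iff.1 hC] with t ht
      by_cases h : t = 0
      · rw [h]; exact h₀'
      · exact ht h
    intro n hn
    rcases n with _ | n
    · exact h₀
    · exact ih h₁ n (by omega)

section

variable {E : Type*} [NormedAddCommGroup E] [NormedSpace ℝ E] {J : E → ℝ}

theorem isBigO_sub_sum_variation (hJ : AnalyticAt ℝ J 0) (N : ℕ) :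
    (fun g => J g - ∑ n ∈ Finset.range N, variation J n 0 g / n.factorial)
      =O[𝓝 0] fun g => ‖g‖ ^ N := by
  obtain ⟨p, hp⟩ := hJ
  have h := hp.isBigO_sub_partialSum_pow N
  obtain ⟨r, hr⟩ := hp
  refine h.congr_left fun g => ?_
  rw [zero_add, FormalMultilinearSeries.partialSum]
  congr 1
  refine Finset.sum_congr rfl fun n _ => ?_
  rw [variation, ← hr.factorial_smul g n, nsmul_eq_mul, mul_div_cancel_left₀]
  exact_mod_cast n.factorial_ne_zero

theorem variation_smul (J : E → ℝ) (n : ℕ) (f g : E) (t : ℝ) :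
    variation J n f (t • g) = t ^ n * variation J n f g := by
  have := (iteratedFDeriv ℝ n J f).map_smul_univ (fun _ => t) fun _ => g
  simpa [variation] using this

/-- Variations are homogeneous, so the Taylor expansion restricted to the line is a second
polynomial with the same error order; the two must have equal coefficients. -/
theorem variation_eq_of_isBigO (hJ : AnalyticAt ℝ J 0) {g : E} {N : ℕ}
    {c : ℕ → ℝ} (hc : (fun t : ℝ => J (t • g) - ∑ n ∈ Finset.range N, c n * t ^ n)
      =O[𝓝 0] fun t => t ^ N) {n : ℕ} (hn : n < N) :
    variation J n 0 g = n.factorial * c n := by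
  have hlim : Tendsto (fun t : ℝ => t • g) (𝓝 0) (𝓝 0) := by
    have : Continuous fun t : ℝ => t • g := by fun_prop
    simpa using this.tendsto 0
  have h₁ := (isBigO_sub_sum_variation hJ N).comp_tendsto hlim
  have h₂ : (fun t : ℝ => ‖t • g‖ ^ N) =O[𝓝 0] fun t => t ^ N := by
    refine IsBigO.of_bound (‖g‖ ^ N) (.of_forall fun t => ?_)
    rw [norm_pow, norm_norm, norm_smul, mul_pow, norm_pow, mul_comm]
  have h₃ := hc.sub (h₁.trans h₂)
  have := eq_zero_of_sum_pow_isBigO (N := N) (c := fun n => variation J n 0 g / n.factorial - c n)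
    (h₃.congr_left fun t => by
      simp only [Function.comp_apply, variation_smul, sub_mul, Finset.sum_sub_distrib]
      rw [sub_sub_sub_cancel_left]
      congr 1
      exact Finset.sum_congr rfl fun n _ => by ring) n hn
  have hf : (n.factorial : ℝ) ≠ 0 := by exact_mod_cast n.factorial_ne_zero
  field_simp at this
  linarith

end

theorem inverse_one_sub_eq_geom_sum_add {R : Type*} [Ring R] {x : R} (hx : IsUnit (1 - x)) (N : ℕ) :
    Ring.inverse (1 - x) = ∑ n ∈ Finset.range N, x ^ n + x ^ N * Ring.inverse (1 - x) := by
  have := congrArg (· * Ring.inverse (1 - x)) (geom_sum_mul_neg x N)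
  simp only [mul_assoc, Ring.mul_inverse_cancel _ hx, mul_one, sub_mul, one_mul] at this
  rw [this, sub_add_cancel]

section

variable {F E : Type*} [NormedAddCommGroup F] [NormedSpace ℝ F] [NormedAddCommGroup E]
  [NormedSpace ℝ E] (X : F →L[ℝ] E →L[ℝ] E)

theorem continuous_one_sub_apply : Continuous fun f => 1 - X f :=
  continuous_const.sub X.continuous

variable [CompleteSpace E]

theorem eventually_isUnit_one_sub : ∀ᶠ f in 𝓝 0, IsUnit (1 - X f) := by
  refine (continuous_one_sub_apply X).continuousAt.eventually (p := IsUnit) ?_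
  simp only [map_zero, sub_zero]
  exact Units.nhds 1

theorem analyticAt_inverse_one_sub_apply (e : E) (Φ : E →L[ℝ] ℂ) :
    AnalyticAt ℝ (fun f => Φ (Ring.inverse (1 - X f) e)) 0 := by
  have h₁ : AnalyticAt ℝ (fun f => 1 - X f) 0 := analyticAt_const.sub (X.analyticAt 0)
  have h₂ : AnalyticAt ℝ Ring.inverse (1 - X 0) := by
    rw [map_zero, sub_zero]
    exact analyticAt_inverse (1 : (E →L[ℝ] E)ˣ)
  exact (Φ.comp (ContinuousLinearMap.apply ℝ E e)).analyticAt _ |>.comp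
    (AnalyticAt.comp (g := Ring.inverse) (f := fun f => 1 - X f) h₂ h₁)

/-- The finite geometric sum has the exact remainder `xᴺ (1 - x)⁻¹`, and inversion is continuous at
1. A remainder continuous at zero can be squared later without further estimates. -/
theorem exists_inverse_one_sub_expansion (e : E) (Φ : E →L[ℝ] ℂ) (g : F) (N : ℕ) :
    ∃ r : ℝ → ℂ, ContinuousAt r 0 ∧ ∀ᶠ t : ℝ in 𝓝 0,
      Φ (Ring.inverse (1 - X (t • g)) e)
        = ∑ n ∈ Finset.range N, Φ ((X g ^ n) e) * t ^ n + t ^ N * r t := by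
  have hlim : Continuous fun t : ℝ => t • g := by fun_prop
  refine ⟨fun t => Φ ((X g ^ N * Ring.inverse (1 - X (t • g))) e), ?_, ?_⟩
  · refine (Φ.comp (ContinuousLinearMap.apply ℝ E e)).continuous.continuousAt.comp
      (f := fun t : ℝ => X g ^ N * Ring.inverse (1 - X (t • g))) (continuousAt_const.mul ?_)
    refine ContinuousAt.comp (g := Ring.inverse) (f := fun t : ℝ => 1 - X (t • g)) ?_
      ((continuous_one_sub_apply X).comp hlim).continuousAt
    rw [zero_smul, map_zero, sub_zero]
    exact NormedRing.inverse_continuousAt (1 : (E →L[ℝ] E)ˣ)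
  · have := hlim.continuousAt (x := 0) |>.eventually (p := fun f => IsUnit (1 - X f))
      (by simpa only [zero_smul] using eventually_isUnit_one_sub X)
    filter_upwards [this] with t ht
    conv_lhs => rw [inverse_one_sub_eq_geom_sum_add ht N, map_smul X]
    simp only [smul_pow, smul_mul_assoc, add_apply, FunLike.coe_sum, Finset.sum_apply,
      smul_apply, map_add, map_sum, map_smul, Complex.real_smul, Complex.ofReal_pow, mul_comm]

end

/-! ### Analyticity of the objective and expansion of the final state. -/

variable (h : Fin 3 → ℝ) (V : Matrix (Fin 3) (Fin 3) ℂ) {T : ℝ} (hT : 0 ≤ T)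

/-- The component `⟨j|g(T)⟩` at time `T` of a path `g`. -/
def finalComponent (j : Fin 3) : Path T →L[ℝ] ℂ :=
  (ContinuousLinearMap.proj (R := ℝ) (φ := fun _ : Fin 3 => ℂ) j).comp
    (ContinuousMap.evalCLM ℝ (⟨T, hT, le_rfl⟩ : Set.Icc (0 : ℝ) T))

theorem analyticAt_solution (j : Fin 3) :
    AnalyticAt ℝ (fun f => solution h V hT f 2 ⟨T, hT, le_rfl⟩ j) 0 :=
  analyticAt_inverse_one_sub_apply (volterra h V hT) (basisPath T 2) (finalComponent hT j)

theorem eventually_isUnit : ∀ᶠ f in 𝓝 0, IsUnit (1 - volterra h V hT f) :=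
  eventually_isUnit_one_sub (volterra h V hT)

theorem analyticAt_objective (hT : 0 ≤ T) (hV : V.IsHermitian) (lam : Fin 3 → ℝ) :
    AnalyticAt ℝ (objective (freeHamiltonian h) V (observable lam) T) 0 := by
  have hn : ∀ j, AnalyticAt ℝ (fun f => ‖solution h V hT f 2 ⟨T, hT, le_rfl⟩ j‖ ^ 2) 0 := by
    intro j
    have h₁ := (Complex.reCLM.analyticAt _).comp (analyticAt_solution h V hT j)
    have h₂ := (Complex.imCLM.analyticAt _).comp (analyticAt_solution h V hT j)
    refine ((h₁.mul h₁).add (h₂.mul h₂)).congr (.of_forall fun f => ?_)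
    simp [← Complex.normSq_eq_norm_sq, Complex.normSq_apply]
  have h₁ := ((analyticAt_const (v := lam 2)).add
    ((analyticAt_const (v := lam 0 - lam 2)).mul (hn 0))).sub
    ((analyticAt_const (v := lam 2 - lam 1)).mul (hn 1))
  refine h₁.congr ?_
  filter_upwards [eventually_isUnit h V hT] with f hf
  exact (objective_eq hf hV lam).symm

theorem exists_solution_expansion (g : Control T) (j : Fin 3) (N : ℕ) :
    ∃ r : ℝ → ℂ, ContinuousAt r 0 ∧ ∀ᶠ t : ℝ in 𝓝 0,
      solution h V hT (t • g) 2 ⟨T, hT, le_rfl⟩ j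
        = ∑ n ∈ Finset.range N, (-Complex.I) ^ n * dysonForm (freeHamiltonian h) V T n j 2 g * t ^ n
          + t ^ N * r t := by
  obtain ⟨r, hr, hr'⟩ := exists_inverse_one_sub_expansion (volterra h V hT) (basisPath T 2)
    (finalComponent hT j) g N
  refine ⟨r, hr, ?_⟩
  filter_upwards [hr'] with t ht
  refine Eq.trans ht ?_
  congr 1
  exact Finset.sum_congr rfl fun n _ => congrArg (· * (t : ℂ) ^ n)
    (volterra_pow_apply h V hT g n ⟨T, hT, le_rfl⟩ j 2)

end

/-! ### Dyson terms of the harmonic system in closed form. -/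

theorem HasACDeriv.eqOn {T : ℝ} (hT : 0 ≤ T) {F G F' G' : ℝ → ℂ} (hF : HasACDeriv T F F')
    (hG : HasACDeriv T G G') (h₀ : F 0 = G 0)
    (h : ∀ t ∈ Set.Icc 0 T, F' t = G' t) : ∀ t ∈ Set.Icc 0 T, F t = G t := by
  intro t ht
  have h₁ := ((hF.sub hG).congr_deriv (G' := fun _ => 0) (by
    rw [ae_restrict_iff' measurableSet_Icc]
    exact .of_forall fun s hs => sub_eq_zero.2 (h s hs))).eq_of_deriv_zero hT ht
  rw [h₀, sub_self] at h₁
  exact sub_eq_zero.1 h₁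

section

variable (h : Fin 3 → ℝ) (V : Matrix (Fin 3) (Fin 3) ℂ) {T : ℝ} (hT : 0 ≤ T) (f : Control T)

theorem dyson_zero (g : ℝ → ℝ) (n : ℕ) (j k : Fin 3) :
    dyson (freeHamiltonian h) V g (n + 1) 0 j k = 0 := by
  simp [dyson]

theorem continuousOn_dyson (hT : 0 ≤ T) (n : ℕ) (j k : Fin 3) :
    ContinuousOn (fun t => dyson (freeHamiltonian h) V f n t j k) (Set.Icc 0 T) := by
  rw [continuousOn_iff_continuous_domRestrict]
  let p : Path T := (volterra h V hT f ^ n) (basisPath T k)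
  have h₁ : Continuous fun t => Complex.I ^ n * p t j := by fun_prop
  convert h₁ using 2 with t
  change _ = _ * (volterra h V hT f ^ n) (basisPath T k) t j
  rw [volterra_pow_apply, ← mul_assoc, ← mul_pow]
  simp

theorem hasACDeriv_dyson (hT : 0 ≤ T) (n : ℕ) (j k : Fin 3) :
    HasACDeriv T (fun t => dyson (freeHamiltonian h) V f (n + 1) t j k) fun s =>
      (f s : ℂ) * ∑ l, interactionPicture (freeHamiltonian h) V s j l
        * dyson (freeHamiltonian h) V f n s l k := by
  have hc : ContinuousOn (fun s => ∑ l, interactionPicture (freeHamiltonian h) V s j l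
      * dyson (freeHamiltonian h) V f n s l k) (Set.Icc 0 T) :=
    continuousOn_finsetSum _ fun l _ =>
      (continuous_interactionPicture_apply h V j l).continuousOn.mul
        (continuousOn_dyson h V f hT n l k)
  exact HasACDeriv.integral hT (integrableOn_control_mul f hc)

end

theorem isHermitian_interactionHamiltonian (v₁₂ v₂₃ : ℂ) :
    (interactionHamiltonian v₁₂ v₂₃).IsHermitian := by
  ext i j
  fin_cases i <;> fin_cases j <;> simp [interactionHamiltonian]

/-- Every interaction changes the parity of the level, since only neighbouring levels are coupled.
-/
theorem dyson_eq_zero (h : Fin 3 → ℝ) (v₁₂ v₂₃ : ℂ) (f : ℝ → ℝ) (n : ℕ) (t : ℝ) (j : Fin 3)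
    (hn : Odd (n + j.val)) :
    dyson (freeHamiltonian h) (interactionHamiltonian v₁₂ v₂₃) f n t j 2 = 0 := by
  induction n generalizing t j with
  | zero =>
    have : j = 1 := by fin_cases j <;> revert hn <;> decide
    simp [dyson, this]
  | succ n ih =>
    have hz : ∀ s, (interactionPicture (freeHamiltonian h) (interactionHamiltonian v₁₂ v₂₃) s
        * dyson (freeHamiltonian h) (interactionHamiltonian v₁₂ v₂₃) f n s) j 2 = 0 := by
      intro s
      rw [Matrix.mul_apply]
      refine Finset.sum_eq_zero fun l _ => ?_
      by_cases hl : Odd (n + l.val)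
      · rw [ih s l hl, mul_zero]
      · have : interactionHamiltonian v₁₂ v₂₃ j l = 0 := by
          have : Even (j.val + l.val) := by
            rw [Nat.not_odd_iff_even] at hl
            grind
          fin_cases j <;> fin_cases l <;>
            first | exact absurd this (by decide) | simp [interactionHamiltonian]
        rw [interactionPicture_apply, this, mul_zero, zero_mul]
    simp [dyson, hz]

/-- The function `f(t) e^{-iωt}`. -/
def wave (ω : ℝ) (f : ℝ → ℝ) (t : ℝ) : ℂ := f t * Complex.exp (-Complex.I * ω * t)

/-- The function `t ↦ ∫₀ᵗ f(s) e^{-iωs} ds`. -/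
def amplitude (ω : ℝ) (f : ℝ → ℝ) (t : ℝ) : ℂ := ∫ s in (0 : ℝ)..t, wave ω f s

/-- The function `t ↦ ∫₀ᵗ f(s) e^{iωs} a(s)ⁿ ds`, where `a` is the amplitude. -/
def amplitudeMoment (ω : ℝ) (f : ℝ → ℝ) (n : ℕ) (t : ℝ) : ℂ :=
  ∫ s in (0 : ℝ)..t, star (wave ω f s) * amplitude ω f s ^ n

section

variable {T : ℝ} (hT : 0 ≤ T) (ω : ℝ) (f : Control T)

theorem hasACDeriv_amplitude (hT : 0 ≤ T) : HasACDeriv T (amplitude ω f) (wave ω f) :=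
  HasACDeriv.integral hT (integrableOn_control_mul f (by fun_prop))

theorem star_wave (ω : ℝ) (f : ℝ → ℝ) (t : ℝ) :
    star (wave ω f t) = f t * Complex.exp (Complex.I * ω * t) := by
  simp [wave, ← Complex.exp_conj]

theorem hasACDeriv_amplitudeMoment (hT : 0 ≤ T) (n : ℕ) : HasACDeriv T (amplitudeMoment ω f n)
    fun s => star (wave ω f s) * amplitude ω f s ^ n := by
  refine HasACDeriv.integral hT ?_
  simp only [star_wave, mul_assoc]
  exact integrableOn_control_mul f (Continuous.continuousOn (by fun_prop) |>.mul
    (((hasACDeriv_amplitude ω f hT).continuousOn hT).pow n))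

theorem amplitude_zero (g : ℝ → ℝ) : amplitude ω g 0 = 0 := by simp [amplitude]

theorem amplitudeMoment_zero (g : ℝ → ℝ) (n : ℕ) : amplitudeMoment ω g n 0 = 0 := by
  simp [amplitudeMoment]

variable {h : Fin 3 → ℝ} {ω : ℝ} (v₁₂ v₂₃ : ℂ)

local notation "D" => dyson (freeHamiltonian h) (interactionHamiltonian v₁₂ v₂₃) f

/-- Harmonicity enters through the three coupling formulas: both allowed transitions have the same
frequency, so a single function `wave` and its conjugate describe them. -/
theorem coupling_zero (hω₁ : h 1 - h 0 = ω) (l : ℝ → Fin 3 → ℂ) (s : ℝ) : (f s : ℂ) * ∑ k,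
    interactionPicture (freeHamiltonian h) (interactionHamiltonian v₁₂ v₂₃) s 0 k * l s k
      = v₁₂ * (wave ω f s * l s 1) := by
  have e : (h 0 : ℂ) - h 1 = -ω := by rw [← hω₁]; push_cast; ring
  simp only [Fin.sum_univ_three, interactionPicture_apply, interactionHamiltonian, wave]
  simp only [Fin.isValue, Matrix.of_apply, Matrix.cons_val', Matrix.cons_val_zero,
    Matrix.cons_val_one, Matrix.cons_val, e]
  ring_nf

theorem coupling_one (hω₁ : h 1 - h 0 = ω) (hω₂ : h 2 - h 1 = ω) (l : ℝ → Fin 3 → ℂ) (s : ℝ) : (f s : ℂ) * ∑ k,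
    interactionPicture (freeHamiltonian h) (interactionHamiltonian v₁₂ v₂₃) s 1 k * l s k
      = star v₁₂ * (star (wave ω f s) * l s 0) + v₂₃ * (wave ω f s * l s 2) := by
  have e₁ : (h 1 : ℂ) - h 0 = ω := by rw [← hω₁]; push_cast; ring
  have e₂ : (h 1 : ℂ) - h 2 = -ω := by rw [← hω₂]; push_cast; ring
  rw [star_wave]
  simp only [Fin.sum_univ_three, interactionPicture_apply, interactionHamiltonian, wave]
  simp only [Fin.isValue, Matrix.of_apply, Matrix.cons_val', Matrix.cons_val_zero,
    Matrix.cons_val_one, Matrix.cons_val, e₁, e₂]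
  ring_nf

theorem coupling_two (hω₂ : h 2 - h 1 = ω) (l : ℝ → Fin 3 → ℂ) (s : ℝ) : (f s : ℂ) * ∑ k,
    interactionPicture (freeHamiltonian h) (interactionHamiltonian v₁₂ v₂₃) s 2 k * l s k
      = star v₂₃ * (star (wave ω f s) * l s 1) := by
  have e : (h 2 : ℂ) - h 1 = ω := by rw [← hω₂]; push_cast; ring
  rw [star_wave]
  simp only [Fin.sum_univ_three, interactionPicture_apply, interactionHamiltonian]
  simp only [Fin.isValue, Matrix.of_apply, Matrix.cons_val', Matrix.cons_val_zero,
    Matrix.cons_val_one, Matrix.cons_val, e]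
  ring_nf

variable (hω₁ : h 1 - h 0 = ω) (hω₂ : h 2 - h 1 = ω)

include hT hω₁ hω₂

theorem dyson_one_eq : ∀ t ∈ Set.Icc 0 T, D 1 t 1 2 = v₂₃ * amplitude ω f t := by
  refine (hasACDeriv_dyson h _ f hT 0 1 2).eqOn hT
    ((hasACDeriv_amplitude ω f hT).const_mul v₂₃) ?_ fun t _ => ?_
  · rw [dyson_zero, amplitude_zero, mul_zero]
  · rw [coupling_one f v₁₂ v₂₃ hω₁ hω₂ fun s l => D 0 s l 2]
    simp [dyson]

theorem dyson_two_zero_eq :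
    ∀ t ∈ Set.Icc 0 T, D 2 t 0 2 = v₁₂ * v₂₃ * (1 / 2) * (amplitude ω f t * amplitude ω f t) := by
  have ha := hasACDeriv_amplitude ω f hT
  refine (hasACDeriv_dyson h _ f hT 1 0 2).eqOn hT ((ha.mul ha).const_mul _) ?_ fun t ht => ?_
  · rw [dyson_zero, amplitude_zero, mul_zero, mul_zero]
  · rw [coupling_zero f v₁₂ v₂₃ hω₁ fun s l => D 1 s l 2,
      dyson_one_eq hT f v₁₂ v₂₃ hω₁ hω₂ t ht]
    ring

theorem dyson_two_two_eq :
    ∀ t ∈ Set.Icc 0 T, D 2 t 2 2 = star v₂₃ * v₂₃ * amplitudeMoment ω f 1 t := by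
  refine (hasACDeriv_dyson h _ f hT 1 2 2).eqOn hT
    ((hasACDeriv_amplitudeMoment ω f hT 1).const_mul _) ?_ fun t ht => ?_
  · rw [dyson_zero, amplitudeMoment_zero, mul_zero]
  · rw [coupling_two f v₁₂ v₂₃ hω₂ fun s l => D 1 s l 2,
      dyson_one_eq hT f v₁₂ v₂₃ hω₁ hω₂ t ht]
    ring

/-- Both sides vanish at zero and have the same derivative. The term `a' M₁` of the integrand is
rewritten as `(a M₁)' - M₂'`, so that the boundary product disappears once `a(T) = 0`. -/
theorem dyson_three_eq : ∀ t ∈ Set.Icc 0 T, D 3 t 1 2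
    = v₂₃ * (star v₁₂ * v₁₂ * (1 / 2) - star v₂₃ * v₂₃) * amplitudeMoment ω f 2 t
      + v₂₃ * (star v₂₃ * v₂₃) * (amplitude ω f t * amplitudeMoment ω f 1 t) := by
  have ha := hasACDeriv_amplitude ω f hT
  refine (hasACDeriv_dyson h _ f hT 2 1 2).eqOn hT
    (((hasACDeriv_amplitudeMoment ω f hT 2).const_mul _).add
      ((ha.mul (hasACDeriv_amplitudeMoment ω f hT 1)).const_mul _)) ?_ fun t ht => ?_
  · rw [dyson_zero, amplitudeMoment_zero, amplitude_zero]
    ring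
  · rw [coupling_one f v₁₂ v₂₃ hω₁ hω₂ fun s l => D 2 s l 2,
      dyson_two_zero_eq hT f v₁₂ v₂₃ hω₁ hω₂ t ht, dyson_two_two_eq hT f v₁₂ v₂₃ hω₁ hω₂ t ht]
    ring

/-- The same integration by parts. With `a(T) = 0` only the moment `M₃` survives, and its factor
vanishes when the two couplings have equal modulus. -/
theorem dyson_four_eq : ∀ t ∈ Set.Icc 0 T, D 4 t 0 2
    = v₁₂ * v₂₃ * (star v₁₂ * v₁₂ * (1 / 2) - star v₂₃ * v₂₃)
        * (amplitude ω f t * amplitudeMoment ω f 2 t)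
      + v₁₂ * v₂₃ * (star v₂₃ * v₂₃) * (1 / 2)
        * (amplitude ω f t * amplitude ω f t * amplitudeMoment ω f 1 t)
      + v₁₂ * v₂₃ * (star v₂₃ * v₂₃ - star v₁₂ * v₁₂) * (1 / 2) * amplitudeMoment ω f 3 t := by
  have ha := hasACDeriv_amplitude ω f hT
  refine (hasACDeriv_dyson h _ f hT 3 0 2).eqOn hT
    ((((ha.mul (hasACDeriv_amplitudeMoment ω f hT 2)).const_mul _).add
      (((ha.mul ha).mul (hasACDeriv_amplitudeMoment ω f hT 1)).const_mul _)).add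
      ((hasACDeriv_amplitudeMoment ω f hT 3).const_mul _)) ?_ fun t ht => ?_
  · rw [dyson_zero, amplitudeMoment_zero, amplitude_zero]
    simp only [amplitudeMoment_zero]
    ring
  · rw [coupling_zero f v₁₂ v₂₃ hω₁ fun s l => D 3 s l 2,
      dyson_three_eq hT f v₁₂ v₂₃ hω₁ hω₂ t ht]
    ring

end

/-! ### Fourier coefficients for the explicit control. -/

/-- By orthogonality of exponentials, only the constant term of a Laurent polynomial survives.
Factoring out `z⁻ᵐ` lets the coefficients be indexed from zero. -/
theorem integral_exp_neg_pow_mul_sum {M : ℕ} (q : Fin M → ℂ) (m : Fin M) :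
    ∫ τ in (0 : ℝ)..2 * Real.pi, Complex.exp (-(Complex.I * τ)) ^ (m : ℕ)
      * ∑ k, q k * Complex.exp (Complex.I * τ) ^ (k : ℕ) = 2 * Real.pi * q m := by
  have e : ∀ (τ : ℝ), Complex.exp (-(Complex.I * τ)) ^ (m : ℕ)
      * ∑ k, q k * Complex.exp (Complex.I * τ) ^ (k : ℕ)
      = ∑ k : Fin M, q k * Complex.exp ((((k : ℕ) : ℂ) - ((m : ℕ) : ℂ)) * Complex.I * τ) := by
    intro τ
    rw [Finset.mul_sum]
    refine Finset.sum_congr rfl fun k _ => ?_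
    rw [mul_left_comm, ← Complex.exp_nat_mul, ← Complex.exp_nat_mul, ← Complex.exp_add]
    congr 2
    ring
  simp only [e]
  rw [intervalIntegral.integral_finsetSum
    (fun k _ => Continuous.intervalIntegrable (by fun_prop) _ _), Finset.sum_eq_single m]
  · simp [mul_comm]
  · intro k _ hk
    have hne : (((k : ℕ) : ℂ) - ((m : ℕ) : ℂ)) * Complex.I ≠ 0 := by
      refine mul_ne_zero (sub_ne_zero.2 ?_) Complex.I_ne_zero
      exact_mod_cast fun h => hk (Fin.ext h)
    rw [intervalIntegral.integral_const_mul, integral_exp_mul_complex hne]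
    have h₁ : Complex.exp ((((k : ℕ) : ℂ) - ((m : ℕ) : ℂ)) * Complex.I * ((2 * Real.pi : ℝ) : ℂ))
        = 1 := by
      rw [← Complex.exp_int_mul_two_pi_mul_I (((k : ℕ) : ℤ) - ((m : ℕ) : ℤ))]
      push_cast
      congr 1
      ring
    rw [h₁]
    simp
  · simp

/-- The trigonometric polynomial `1 - iD sin 2τ + C cos 3τ`. -/
def profile (D C : ℂ) (τ : ℝ) : ℂ :=
  1 + D / 2 * (Complex.exp (-(Complex.I * τ)) ^ 2 - Complex.exp (Complex.I * τ) ^ 2)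
    + C / 2 * (Complex.exp (Complex.I * τ) ^ 3 + Complex.exp (-(Complex.I * τ)) ^ 3)

/-- The integral over `[0, τ]` of `-i e^{-iτ}` times the profile. -/
def profilePrimitive (D C : ℂ) (τ : ℝ) : ℂ :=
  Complex.exp (-(Complex.I * τ)) + D / 2 * Complex.exp (Complex.I * τ)
    + D / 6 * Complex.exp (-(Complex.I * τ)) ^ 3 - C / 4 * Complex.exp (Complex.I * τ) ^ 2
    + C / 8 * Complex.exp (-(Complex.I * τ)) ^ 4 + (-1 - 2 / 3 * D + C / 8)

theorem hasDerivAt_profilePrimitive (D C : ℂ) (τ : ℝ) : HasDerivAt (profilePrimitive D C)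
    (-Complex.I * (profile D C τ * Complex.exp (-(Complex.I * τ)))) τ := by
  have h₀ : HasDerivAt (fun τ : ℝ => Complex.I * (τ : ℂ)) (Complex.I * 1) τ :=
    (Complex.ofRealCLM.hasDerivAt (x := τ)).const_mul Complex.I
  have h₁ := h₀.cexp
  have h₂ : HasDerivAt (fun τ : ℝ => Complex.exp (-(Complex.I * τ)))
      (Complex.exp (-(Complex.I * τ)) * -(Complex.I * 1)) τ := h₀.neg.cexp
  refine (((((h₂.add (h₁.const_mul (D / 2))).add ((h₂.pow 3).const_mul (D / 6))).sub
    ((h₁.pow 2).const_mul (C / 4))).add ((h₂.pow 4).const_mul (C / 8))).add_const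
    (-1 - 2 / 3 * D + C / 8)).congr_deriv ?_
  have hz := Complex.exp_ne_zero (Complex.I * τ)
  simp only [profile, Complex.exp_neg, Nat.cast_ofNat, Nat.reduceSub]
  generalize Complex.exp (Complex.I * τ) = z at hz
  field_simp
  ring

theorem continuous_profile (D C : ℂ) : Continuous (profile D C) := by
  unfold profile
  fun_prop

theorem profilePrimitive_zero (D C : ℂ) : profilePrimitive D C 0 = 0 := by
  simp only [profilePrimitive, Complex.ofReal_zero, mul_zero, neg_zero, Complex.exp_zero]
  ring

theorem profilePrimitive_two_pi (D C : ℂ) : profilePrimitive D C (2 * Real.pi) = 0 := by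
  have h : Complex.exp (Complex.I * ((2 * Real.pi : ℝ) : ℂ)) = 1 := by
    push_cast
    rw [mul_comm, Complex.exp_two_pi_mul_I]
  rw [profilePrimitive, Complex.exp_neg, h]
  ring

/-- In `z = e^{iτ}` the integrand is a Laurent polynomial with exponents from -10 to 8, so its
constant term is entry 10 of the 19 coefficients. -/
theorem integral_profile_mul_sq (D C : ℂ) :
    ∫ τ in (0 : ℝ)..2 * Real.pi, profile D C τ * Complex.exp (Complex.I * τ)
      * profilePrimitive D C τ ^ 2
    = 2 * Real.pi * (-2 + 1 / 4 * C + 1 / 8 * C ^ 2 - 1 / 64 * C ^ 3 - 4 / 3 * D - 1 / 6 * D * C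
        + 1 / 12 * D * C ^ 2 - 1 / 3 * D ^ 2 + 5 / 48 * D ^ 2 * C - 2 / 9 * D ^ 3) := by
  refine Eq.trans (intervalIntegral.integral_congr fun τ _ => ?_) (integral_exp_neg_pow_mul_sum
    (M := 19) ![
      1 / 128 * C ^ 3,
      11 / 384 * D * C ^ 2,
      5 / 144 * D ^ 2 * C,
      9 / 64 * C ^ 2 + 1 / 72 * D ^ 3,
      -1 / 8 * C ^ 2 + 1 / 64 * C ^ 3 + 1 / 3 * D * C - 1 / 12 * D * C ^ 2,
      -7 / 24 * D * C + 35 / 384 * D * C ^ 2 + 7 / 36 * D ^ 2 - 7 / 36 * D ^ 2 * C,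
      3 / 4 * C - 3 / 128 * C ^ 3 - 1 / 6 * D ^ 2 + 7 / 48 * D ^ 2 * C - 1 / 9 * D ^ 3,
      -5 / 4 * C + 5 / 32 * C ^ 2 + 5 / 6 * D - 5 / 6 * D * C - 5 / 96 * D * C ^ 2
        + 5 / 72 * D ^ 3,
      1 / 2 * C - 1 / 8 * C ^ 2 + 1 / 128 * C ^ 3 - 4 / 3 * D + 4 / 3 * D * C - 1 / 12 * D * C ^ 2
        - 8 / 9 * D ^ 2 + 7 / 36 * D ^ 2 * C,
      1 - 3 / 16 * C ^ 2 + 1 / 2 * D - 1 / 2 * D * C + 7 / 128 * D * C ^ 2 + 7 / 6 * D ^ 2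
        - 1 / 3 * D ^ 2 * C + 2 / 9 * D ^ 3,
      -2 + 1 / 4 * C + 1 / 8 * C ^ 2 - 1 / 64 * C ^ 3 - 4 / 3 * D - 1 / 6 * D * C
        + 1 / 12 * D * C ^ 2 - 1 / 3 * D ^ 2 + 5 / 48 * D ^ 2 * C - 2 / 9 * D ^ 3,
      1 - 1 / 4 * C + 1 / 64 * C ^ 2 + 11 / 6 * D - 1 / 12 * D * C - 1 / 24 * D * C ^ 2
        + 4 / 9 * D ^ 2 + 1 / 18 * D ^ 2 * C + 1 / 24 * D ^ 3,
      0,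
      -1 / 2 * C + 1 / 16 * C ^ 2 - 1 / 2 * D - 5 / 24 * D * C - 7 / 384 * D * C ^ 2
        - 11 / 12 * D ^ 2 + 1 / 12 * D ^ 2 * C - 2 / 9 * D ^ 3,
      1 / 2 * C - 1 / 8 * C ^ 2 + 1 / 128 * C ^ 3 + 7 / 6 * D * C - 1 / 12 * D * C ^ 2
        + 1 / 2 * D ^ 2 + 23 / 144 * D ^ 2 * C + 1 / 3 * D ^ 3,
      -3 / 16 * C ^ 2 - 3 / 4 * D * C + 3 / 32 * D * C ^ 2 - 1 / 2 * D ^ 2 * C - 1 / 8 * D ^ 3,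
      1 / 4 * C ^ 2 - 1 / 32 * C ^ 3 + 1 / 6 * D * C ^ 2 + 1 / 4 * D ^ 2 * C,
      -5 / 32 * D * C ^ 2,
      1 / 32 * C ^ 3] (10 : Fin 19))
  have hz := Complex.exp_ne_zero (Complex.I * τ)
  simp only [profile, profilePrimitive, Complex.exp_neg]
  generalize Complex.exp (Complex.I * τ) = z at hz
  simp only [Fin.sum_univ_succ, Fin.sum_univ_zero, Matrix.cons_val_zero, Matrix.cons_val_succ,
    Fin.val_succ, Fin.coe_ofNat_eq_mod, Nat.reduceMod]
  field_simp
  ring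

set_option maxHeartbeats 1000000 in
/-- The Fourier coefficients, from `-14` to `10`, of `e^{iτ}` times the profile times the cube of
its primitive. -/
def cubeCoefficients (D C : ℂ) : Fin 25 → ℂ := ![
      1 / 1024 * C ^ 4,
      5 / 1024 * D * C ^ 3,
      7 / 768 * D ^ 2 * C ^ 2,
      13 / 512 * C ^ 3 + 13 / 1728 * D ^ 3 * C,
      -3 / 128 * C ^ 3 + 3 / 1024 * C ^ 4 + 3 / 32 * D * C ^ 2 - 1 / 64 * D * C ^ 3
        + 1 / 432 * D ^ 4,
      -11 / 128 * D * C ^ 2 + 11 / 512 * D * C ^ 3 + 11 / 96 * D ^ 2 * C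
        - 11 / 192 * D ^ 2 * C ^ 2,
      15 / 64 * C ^ 2 - 5 / 1024 * C ^ 4 - 5 / 48 * D ^ 2 * C + 5 / 96 * D ^ 2 * C ^ 2
        + 5 / 108 * D ^ 3 - 5 / 72 * D ^ 3 * C,
      -27 / 64 * C ^ 2 + 27 / 512 * C ^ 3 + 9 / 16 * D * C - 9 / 32 * D * C ^ 2
        - 9 / 512 * D * C ^ 3 - 1 / 24 * D ^ 3 + 5 / 96 * D ^ 3 * C - 1 / 36 * D ^ 4,
      3 / 16 * C ^ 2 - 3 / 64 * C ^ 3 + 3 / 1024 * C ^ 4 - D * C + 9 / 16 * D * C ^ 2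
        - 1 / 32 * D * C ^ 3 + 1 / 3 * D ^ 2 - 2 / 3 * D ^ 2 * C + 1 / 16 * D ^ 2 * C ^ 2
        + 1 / 54 * D ^ 4,
      7 / 8 * C - 21 / 256 * C ^ 3 + 7 / 16 * D * C - 35 / 128 * D * C ^ 2 + 7 / 256 * D * C ^ 3
        - 7 / 12 * D ^ 2 + 35 / 32 * D ^ 2 * C - 35 / 192 * D ^ 2 * C ^ 2 - 7 / 18 * D ^ 3
        + 161 / 864 * D ^ 3 * C,
      -9 / 4 * C + 9 / 32 * C ^ 2 + 9 / 128 * C ^ 3 - 9 / 1024 * C ^ 4 + D - 3 / 2 * D * C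
        - 3 / 16 * D * C ^ 2 + 3 / 64 * D * C ^ 3 + 1 / 4 * D ^ 2 - 7 / 16 * D ^ 2 * C
        + 11 / 128 * D ^ 2 * C ^ 2 + 7 / 12 * D ^ 3 - 7 / 24 * D ^ 3 * C + 1 / 9 * D ^ 4,
      15 / 8 * C - 15 / 32 * C ^ 2 + 15 / 512 * C ^ 3 - 5 / 2 * D + 15 / 4 * D * C
        - 5 / 32 * D * C ^ 2 - 25 / 512 * D * C ^ 3 - 5 / 3 * D ^ 2 + 35 / 48 * D ^ 2 * C
        + 5 / 48 * D ^ 2 * C ^ 2 - 5 / 24 * D ^ 3 + 5 / 48 * D ^ 3 * C - 5 / 36 * D ^ 4,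
      1 - 1 / 2 * C - 3 / 16 * C ^ 2 - 3 / 128 * C ^ 3 + 7 / 1024 * C ^ 4 + 2 * D - 3 * D * C
        + 15 / 32 * D * C ^ 2 - 1 / 64 * D * C ^ 3 + 11 / 3 * D ^ 2 - 23 / 12 * D ^ 2 * C
        + 1 / 96 * D ^ 2 * C ^ 2 + 8 / 9 * D ^ 3 - 5 / 54 * D ^ 3 * C + 1 / 24 * D ^ 4,
      -3 + 3 / 8 * C + 9 / 16 * C ^ 2 - 9 / 128 * C ^ 3 - 5 / 2 * D + 3 / 8 * D * C
        + 27 / 128 * D * C ^ 2 + 11 / 512 * D * C ^ 3 - 5 / 2 * D ^ 2 + 47 / 32 * D ^ 2 * C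
        - 7 / 64 * D ^ 2 * C ^ 2 - 5 / 3 * D ^ 3 + 29 / 96 * D ^ 3 * C - 4 / 27 * D ^ 4,
      3 - 3 / 4 * C - 9 / 64 * C ^ 2 + 3 / 64 * C ^ 3 - 3 / 1024 * C ^ 4 + 5 * D
        - 1 / 2 * D * C ^ 2 + 1 / 32 * D * C ^ 3 + 11 / 6 * D ^ 2 + 1 / 48 * D ^ 2 * C
        - 3 / 64 * D ^ 2 * C ^ 2 + 11 / 12 * D ^ 3 - 5 / 24 * D ^ 3 * C + 2 / 9 * D ^ 4,
      -1 + 1 / 8 * C - 3 / 64 * C ^ 2 + 13 / 512 * C ^ 3 - 7 / 2 * D + 9 / 16 * D * C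
        + 3 / 32 * D * C ^ 2 - 7 / 512 * D * C ^ 3 - 7 / 3 * D ^ 2 - 1 / 8 * D ^ 2 * C
        + 1 / 12 * D ^ 2 * C ^ 2 - 91 / 216 * D ^ 3 - 7 / 288 * D ^ 3 * C - 1 / 12 * D ^ 4,
      0,
      3 / 4 * C - 3 / 16 * C ^ 2 + 3 / 256 * C ^ 3 + 1 / 2 * D + 19 / 16 * D * C
        - 9 / 128 * D * C ^ 2 - 17 / 1024 * D * C ^ 3 + 7 / 4 * D ^ 2 - 1 / 96 * D ^ 2 * C
        + 7 / 192 * D ^ 2 * C ^ 2 + 7 / 6 * D ^ 3 - 5 / 96 * D ^ 3 * C + 4 / 27 * D ^ 4,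
      -1 / 2 * C - 3 / 128 * C ^ 3 + 5 / 1024 * C ^ 4 - 5 / 2 * D * C + 7 / 16 * D * C ^ 2
        - 1 / 64 * D * C ^ 3 - 3 / 4 * D ^ 2 - 71 / 48 * D ^ 2 * C + 31 / 768 * D ^ 2 * C ^ 2
        - 5 / 4 * D ^ 3 - 5 / 216 * D ^ 3 * C - 1 / 3 * D ^ 4,
      9 / 16 * C ^ 2 - 9 / 128 * C ^ 3 + 9 / 8 * D * C + 3 / 32 * D * C ^ 2 + 13 / 512 * D * C ^ 3
        + 33 / 16 * D ^ 2 * C - 3 / 16 * D ^ 2 * C ^ 2 + 3 / 8 * D ^ 3 + 29 / 64 * D ^ 3 * C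
        + 1 / 4 * D ^ 4,
      -3 / 8 * C ^ 2 + 3 / 32 * C ^ 3 - 3 / 512 * C ^ 4 - 7 / 8 * D * C ^ 2 + 1 / 16 * D * C ^ 3
        - 3 / 4 * D ^ 2 * C - 7 / 96 * D ^ 2 * C ^ 2 - 1 / 2 * D ^ 3 * C - 1 / 16 * D ^ 4,
      5 / 64 * C ^ 3 + 15 / 32 * D * C ^ 2 - 15 / 256 * D * C ^ 3 + 5 / 16 * D ^ 2 * C ^ 2
        + 5 / 32 * D ^ 3 * C,
      -3 / 32 * C ^ 3 + 3 / 256 * C ^ 4 - 1 / 16 * D * C ^ 3 - 9 / 64 * D ^ 2 * C ^ 2,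
      7 / 128 * D * C ^ 3,
      -1 / 128 * C ^ 4]

set_option maxHeartbeats 1000000 in
theorem integral_profile_mul_cube (D C : ℂ) :
    ∫ τ in (0 : ℝ)..2 * Real.pi, profile D C τ * Complex.exp (Complex.I * τ)
      * profilePrimitive D C τ ^ 3
    = 2 * Real.pi * (3 - 3 / 4 * C - 9 / 64 * C ^ 2 + 3 / 64 * C ^ 3 - 3 / 1024 * C ^ 4 + 5 * D
        - 1 / 2 * D * C ^ 2 + 1 / 32 * D * C ^ 3 + 11 / 6 * D ^ 2 + 1 / 48 * D ^ 2 * C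
        - 3 / 64 * D ^ 2 * C ^ 2 + 11 / 12 * D ^ 3 - 5 / 24 * D ^ 3 * C + 2 / 9 * D ^ 4) := by
  -- The lowest exponent is -14, so the constant term is entry 14.
  refine Eq.trans (intervalIntegral.integral_congr fun τ _ => ?_) (integral_exp_neg_pow_mul_sum
    (M := 25) (cubeCoefficients D C) (14 : Fin 25))
  have hz := Complex.exp_ne_zero (Complex.I * τ)
  simp only [profile, profilePrimitive, Complex.exp_neg]
  generalize Complex.exp (Complex.I * τ) = z at hz
  simp only [cubeCoefficients, Fin.sum_univ_succ, Fin.sum_univ_zero, Matrix.cons_val_zero, Matrix.cons_val_succ,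
    Fin.val_succ, Fin.coe_ofNat_eq_mod, Nat.reduceMod]
  field_simp
  ring

/-! ### Amplitude and moments of the explicit control. -/

theorem intervalIntegral_star (u : ℝ → ℂ) (a b : ℝ) :
    ∫ s in a..b, star (u s) = star (∫ s in a..b, u s) := by
  simp only [intervalIntegral, Complex.star_def, integral_conj, map_sub]

theorem wave_neg (ω : ℝ) (f : ℝ → ℝ) (t : ℝ) : wave (-ω) f t = star (wave ω f t) := by
  rw [star_wave, wave]
  simp

/-- Controls are real, so reversing the sign of the frequency conjugates everything; this reduces
the computation to the frequency `|ω|`. -/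
theorem amplitude_neg (ω : ℝ) (f : ℝ → ℝ) (t : ℝ) :
    amplitude (-ω) f t = star (amplitude ω f t) := by
  simp only [amplitude, wave_neg, intervalIntegral_star]

theorem amplitudeMoment_neg (ω : ℝ) (f : ℝ → ℝ) (n : ℕ) (t : ℝ) :
    amplitudeMoment (-ω) f n t = star (amplitudeMoment ω f n t) := by
  simp only [amplitudeMoment, wave_neg, amplitude_neg, ← star_pow, ← star_mul',
    intervalIntegral_star]

theorem amplitude_congr {T ω : ℝ} {f g : ℝ → ℝ} (hfg : f =ᵐ[volume.restrict (Set.Icc 0 T)] g)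
    {t : ℝ} (ht : t ∈ Set.Icc 0 T) : amplitude ω f t = amplitude ω g t := by
  refine intervalIntegral_congr_of_ae_restrict ?_ ht
  filter_upwards [hfg] with s hs
  rw [wave, wave, hs]

theorem amplitudeMoment_congr {T ω : ℝ} {f g : ℝ → ℝ}
    (hfg : f =ᵐ[volume.restrict (Set.Icc 0 T)] g) (n : ℕ) {t : ℝ} (ht : t ∈ Set.Icc 0 T) :
    amplitudeMoment ω f n t = amplitudeMoment ω g n t := by
  refine intervalIntegral_congr_of_ae_restrict ?_ ht
  filter_upwards [hfg, ae_restrict_mem measurableSet_Icc] with s hs hsT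
  rw [wave, wave, hs, amplitude_congr hfg hsT]

/-- The parameter `iB` of the special control. -/
def specialD : ℂ := Complex.I * (Real.sqrt (19 - Real.sqrt 73) / Real.sqrt 6 : ℝ)

/-- The parameter `C` of the special control. -/
def specialC : ℂ := ((5 + Real.sqrt 73) / 3 : ℝ)

theorem specialControl_eq_profile {ω t : ℝ} (ht : t ∈ Set.Icc 0 (2 * Real.pi / |ω|)) :
    (specialControl ω t : ℂ) = profile specialD specialC (|ω| * t) := by
  rw [specialControl, Set.indicator_of_mem ht, profile, specialD, specialC]
  push_cast
  rw [Complex.sin, Complex.cos, ← Complex.exp_nat_mul, ← Complex.exp_nat_mul,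
    ← Complex.exp_nat_mul, ← Complex.exp_nat_mul]
  push_cast
  ring_nf

theorem specialControl_eq_zero {ω t : ℝ} (ht : 2 * Real.pi / |ω| < t) :
    specialControl ω t = 0 :=
  Set.indicator_of_notMem (fun h => absurd h.2 (not_le.2 ht)) _

theorem wave_specialControl {r t : ℝ} (hr : 0 < r) (ht : t ∈ Set.Icc 0 (2 * Real.pi / r)) :
    wave r (specialControl r) t
      = profile specialD specialC (r * t) * Complex.exp (-(Complex.I * (r * t : ℝ))) := by
  rw [wave, specialControl_eq_profile (by rwa [abs_of_pos hr]), abs_of_pos hr]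
  congr 2
  push_cast
  ring

theorem amplitude_specialControl {r t : ℝ} (hr : 0 < r) (ht : t ∈ Set.Icc 0 (2 * Real.pi / r)) :
    amplitude r (specialControl r) t
      = Complex.I / r * profilePrimitive specialD specialC (r * t) := by
  have hr' : (r : ℂ) ≠ 0 := by exact_mod_cast hr.ne'
  have h₁ : ∫ s in (0 : ℝ)..t, profile specialD specialC (r * s)
      * Complex.exp (-(Complex.I * (r * s : ℝ)))
      = Complex.I / r * profilePrimitive specialD specialC (r * t)
        - Complex.I / r * profilePrimitive specialD specialC (r * 0) := by
    refine intervalIntegral.integral_eq_sub_of_hasDerivAt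
      (f := fun s : ℝ => Complex.I / r * profilePrimitive specialD specialC (r * s)) (fun s _ => ?_)
      (Continuous.intervalIntegrable ?_ _ _)
    · have h₂ : HasDerivAt (fun s : ℝ => r * s) (r * 1) s := (hasDerivAt_id s).const_mul r
      have h₃ := HasDerivAt.scomp (h := fun s : ℝ => r * s) s
        (hasDerivAt_profilePrimitive specialD specialC (r * s)) h₂
      refine (h₃.const_mul (Complex.I / r)).congr_deriv ?_
      rw [Complex.real_smul]
      push_cast
      field_simp
      linear_combination (-profile specialD specialC (r * s)) * Complex.I_sq
    · have := continuous_profile specialD specialC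
      fun_prop
  rw [mul_zero, profilePrimitive_zero, mul_zero, sub_zero] at h₁
  rw [← h₁, amplitude]
  refine intervalIntegral.integral_congr fun s hs => ?_
  rw [Set.uIcc_of_le ht.1] at hs
  exact wave_specialControl hr ⟨hs.1, hs.2.trans ht.2⟩

theorem integral_eq_of_eq_zero {u : ℝ → ℂ} {p T : ℝ} (hp : 0 ≤ p) (hpT : p ≤ T)
    (hu : ∀ t, p < t → u t = 0) : ∫ s in (0 : ℝ)..T, u s = ∫ s in (0 : ℝ)..p, u s := by
  rw [intervalIntegral.integral_of_le (hp.trans hpT), intervalIntegral.integral_of_le hp]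
  refine setIntegral_eq_of_subset_of_forall_sdiff_eq_zero measurableSet_Ioc
    (Set.Ioc_subset_Ioc_right hpT) fun t ht => hu t ?_
  by_contra h
  exact ht.2 ⟨ht.1.1, not_lt.1 h⟩

theorem amplitude_specialControl_final {r T : ℝ} (hr : 0 < r) (hT : 2 * Real.pi / r ≤ T) :
    amplitude r (specialControl r) T = 0 := by
  have hp : 0 ≤ 2 * Real.pi / r := by positivity
  rw [amplitude, integral_eq_of_eq_zero hp hT fun t ht => by
    rw [wave, specialControl_eq_zero (by rwa [abs_of_pos hr])]; simp]
  change amplitude r (specialControl r) _ = 0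
  rw [amplitude_specialControl hr ⟨hp, le_rfl⟩, mul_div_cancel₀ _ hr.ne', profilePrimitive_two_pi,
    mul_zero]

theorem amplitudeMoment_specialControl {r T : ℝ} (hr : 0 < r) (hT : 2 * Real.pi / r ≤ T) (n : ℕ) :
    amplitudeMoment r (specialControl r) n T = (Complex.I / r) ^ n / r
      * ∫ τ in (0 : ℝ)..2 * Real.pi, profile specialD specialC τ * Complex.exp (Complex.I * τ)
        * profilePrimitive specialD specialC τ ^ n := by
  have hp : 0 ≤ 2 * Real.pi / r := by positivity
  have hr' : (r : ℂ) ≠ 0 := by exact_mod_cast hr.ne'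
  rw [amplitudeMoment, integral_eq_of_eq_zero hp hT fun t ht => by
    rw [wave, specialControl_eq_zero (by rwa [abs_of_pos hr])]; simp]
  have h₁ := intervalIntegral.smul_integral_comp_mul_left (a := 0) (b := 2 * Real.pi / r)
    (fun τ : ℝ => profile specialD specialC τ * Complex.exp (Complex.I * τ)
        * profilePrimitive specialD specialC τ ^ n) r
  rw [mul_zero, mul_div_cancel₀ _ hr.ne', Complex.real_smul] at h₁
  rw [← h₁, ← mul_assoc, div_mul_cancel₀ _ hr', ← intervalIntegral.integral_const_mul]
  refine intervalIntegral.integral_congr fun s hs => ?_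
  rw [Set.uIcc_of_le hp] at hs
  have e : star (wave r (specialControl r) s)
      = profile specialD specialC (r * s) * Complex.exp (Complex.I * (r * s : ℝ)) := by
    rw [star_wave, specialControl_eq_profile (by rwa [abs_of_pos hr]), abs_of_pos hr]
    congr 2
    push_cast
    ring
  simp only [e, amplitude_specialControl hr hs, mul_pow]
  ring

theorem specialD_sq : specialD ^ 2 = -((19 - (Real.sqrt 73 : ℝ)) / 6 : ℝ) := by
  have h₁ : Real.sqrt 73 ≤ 19 := by
    rw [Real.sqrt_le_left (by norm_num)]
    norm_num
  rw [specialD, mul_pow, Complex.I_sq, ← Complex.ofReal_pow, div_pow, Real.sq_sqrt (by linarith),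
    Real.sq_sqrt (by norm_num), neg_one_mul]

theorem sqrt_seventyThree_sq : ((Real.sqrt 73 : ℝ) : ℂ) ^ 2 = 73 := by
  rw [← Complex.ofReal_pow, Real.sq_sqrt (by norm_num)]
  norm_num

/-- After replacing `D²` by its value, the constant term has the form `P(s) + D Q(s)` with `s =
√73`. Both `P` and `Q` are divisible by `s² - 73`; the quotients are the multipliers in
`linear_combination`. -/
theorem integral_special_sq_eq_zero :
    ∫ τ in (0 : ℝ)..2 * Real.pi, profile specialD specialC τ * Complex.exp (Complex.I * τ)
      * profilePrimitive specialD specialC τ ^ 2 = 0 := by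
  rw [integral_profile_mul_sq]
  have hD := specialD_sq
  have hC : specialC = (5 + (Real.sqrt 73 : ℝ)) / 3 := by rw [specialC]; push_cast; rfl
  have hs := sqrt_seventyThree_sq
  push_cast at hD
  generalize specialD = D at hD ⊢
  rw [hC]
  generalize ((Real.sqrt 73 : ℝ) : ℂ) = s at hs hD ⊢
  refine mul_eq_zero_of_right _ ?_
  rw [show D ^ 3 = D * D ^ 2 by ring, hD]
  linear_combination (-s / 1728 + 19 / 1728 + D / 108) * hs

/-- Since `D` is imaginary and `D²`, `C` are real, the even powers of `D` give the real part of the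
constant term. Reduced by `s² = 73`, it has modulus `(4603 + 887 s) / 10368`, which is positive. -/
theorem integral_special_cube_ne_zero :
    ∫ τ in (0 : ℝ)..2 * Real.pi, profile specialD specialC τ * Complex.exp (Complex.I * τ)
      * profilePrimitive specialD specialC τ ^ 3 ≠ 0 := by
  rw [integral_profile_mul_cube]
  have hD := specialD_sq
  have hC : specialC = (5 + (Real.sqrt 73 : ℝ)) / 3 := by rw [specialC]; push_cast; rfl
  have hs := sqrt_seventyThree_sq
  have hs₀ : 0 ≤ Real.sqrt 73 := Real.sqrt_nonneg _
  have hre : ∀ y : ℝ, (specialD * (y : ℂ)).re = 0 := by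
    intro y
    rw [specialD, mul_assoc, ← Complex.ofReal_mul, Complex.I_mul_re, Complex.ofReal_im, neg_zero]
  push_cast at hD
  generalize specialD = D at hD hre ⊢
  rw [hC]
  generalize Real.sqrt 73 = s at hs hs₀ hD ⊢
  refine mul_ne_zero (by simp [Real.pi_ne_zero]) fun h₀ => ?_
  have h₁ : D * ((5 - 1 / 2 * ((5 + s) / 3) ^ 2 + 1 / 32 * ((5 + s) / 3) ^ 3
      - (19 - s) / 6 * (11 / 12 - 5 / 24 * ((5 + s) / 3)) : ℝ) : ℂ)
      = ((4603 / 10368 + 887 / 10368 * s : ℝ) : ℂ) := by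
    rw [show D ^ 3 = D * D ^ 2 by ring, show D ^ 4 = D ^ 2 * D ^ 2 by ring, hD] at h₀
    push_cast
    linear_combination h₀ + ((s : ℂ) ^ 2 / 27648 - s / 6912 - 1451 / 82944) * hs
  have h₂ := congrArg Complex.re h₁
  rw [hre, Complex.ofReal_re] at h₂
  linarith

/-! ### Expansion of the objective along a line. -/

theorem isBigO_of_eq_pow_mul {u R : ℝ → ℝ} {N : ℕ} (hR : ContinuousAt R 0)
    (h : ∀ᶠ t in 𝓝 0, u t = t ^ N * R t) : u =O[𝓝 0] fun t => t ^ N := by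
  have h₁ := (isBigO_refl (fun t : ℝ => t ^ N) (𝓝 0)).mul (hR.tendsto.isBigO_one ℝ)
  simp only [mul_one] at h₁
  exact h₁.congr' (h.mono fun t ht => ht.symm) .rfl

theorem sq_even_expansion {x ρ : ℝ → ℝ} {x₂ x₄ x₆ x₈ : ℝ} (hρ : ContinuousAt ρ 0)
    (hx : ∀ᶠ t in 𝓝 0, x t = -x₂ * t ^ 2 + x₄ * t ^ 4 - x₆ * t ^ 6 + x₈ * t ^ 8 + t ^ 10 * ρ t) :
    (fun t => x t ^ 2 - (x₂ ^ 2 * t ^ 4 - 2 * (x₂ * x₄) * t ^ 6 + (x₄ ^ 2 + 2 * (x₂ * x₆)) * t ^ 8))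
      =O[𝓝 0] fun t => t ^ 10 := by
  refine isBigO_of_eq_pow_mul (R := fun t => -(2 * x₂ * x₈ + 2 * x₄ * x₆)
    + (x₆ ^ 2 + 2 * x₄ * x₈) * t ^ 2 - 2 * x₆ * x₈ * t ^ 4 + x₈ ^ 2 * t ^ 6
    + 2 * (-x₂ * t ^ 2 + x₄ * t ^ 4 - x₆ * t ^ 6 + x₈ * t ^ 8) * ρ t + t ^ 10 * ρ t ^ 2)
    (by fun_prop) ?_
  filter_upwards [hx] with t ht
  rw [ht]
  ring

theorem sq_odd_expansion {x ρ : ℝ → ℝ} {x₁ x₃ x₅ x₇ x₉ : ℝ} (hρ : ContinuousAt ρ 0)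
    (hx : ∀ᶠ t in 𝓝 0, x t = x₁ * t - x₃ * t ^ 3 + x₅ * t ^ 5 - x₇ * t ^ 7 + x₉ * t ^ 9
      + t ^ 10 * ρ t) :
    (fun t => x t ^ 2 - (x₁ ^ 2 * t ^ 2 - 2 * (x₁ * x₃) * t ^ 4 + (x₃ ^ 2 + 2 * (x₁ * x₅)) * t ^ 6
      - 2 * (x₁ * x₇ + x₃ * x₅) * t ^ 8)) =O[𝓝 0] fun t => t ^ 10 := by
  refine isBigO_of_eq_pow_mul (R := fun t => x₅ ^ 2 + 2 * x₁ * x₉ + 2 * x₃ * x₇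
    - (2 * x₅ * x₇ + 2 * x₃ * x₉) * t ^ 2 + (x₇ ^ 2 + 2 * x₅ * x₉) * t ^ 4
    - 2 * x₇ * x₉ * t ^ 6 + x₉ ^ 2 * t ^ 8
    + 2 * (x₁ * t - x₃ * t ^ 3 + x₅ * t ^ 5 - x₇ * t ^ 7 + x₉ * t ^ 9) * ρ t + t ^ 10 * ρ t ^ 2)
    (by fun_prop) ?_
  filter_upwards [hx] with t ht
  rw [ht]
  ring

/-- The Taylor coefficients of the objective along a line, in terms of the forms
`a n = Aⁿ₁₃⟨g⟩` and `b n = Aⁿ₂₃⟨g⟩`. -/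
def expansionCoeff (lam : Fin 3 → ℝ) (a b : ℕ → ℂ) : ℕ → ℝ
  | 0 => lam 2
  | 2 => -((lam 2 - lam 1) * ‖b 1‖ ^ 2)
  | 4 => (lam 0 - lam 2) * ‖a 2‖ ^ 2
      + 2 * (lam 2 - lam 1) * ((b 1).re * (b 3).re + (b 1).im * (b 3).im)
  | 6 => -(2 * (lam 0 - lam 2) * ((a 2).re * (a 4).re + (a 2).im * (a 4).im))
      - (lam 2 - lam 1) * (‖b 3‖ ^ 2 + 2 * ((b 1).re * (b 5).re + (b 1).im * (b 5).im))
  | 8 => (lam 0 - lam 2) * (‖a 4‖ ^ 2 + 2 * ((a 2).re * (a 6).re + (a 2).im * (a 6).im))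
      + 2 * (lam 2 - lam 1) * ((b 1).re * (b 7).re + (b 1).im * (b 7).im
        + ((b 3).re * (b 5).re + (b 3).im * (b 5).im))
  | _ => 0

theorem norm_sq_eq_re_add_im (z : ℂ) : ‖z‖ ^ 2 = z.re ^ 2 + z.im ^ 2 := by
  rw [← Complex.normSq_eq_norm_sq, Complex.normSq_apply]
  ring

section

variable (h lam : Fin 3 → ℝ) (v₁₂ v₂₃ : ℂ) {T : ℝ}

/-- Parity leaves even powers in the amplitude of level 1 and odd powers in that of level 2. Their
real and imaginary parts are squared separately. -/
theorem objective_expansion (hT : 0 ≤ T) (g : Control T) :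
    (fun t : ℝ => objective (freeHamiltonian h) (interactionHamiltonian v₁₂ v₂₃) (observable lam) T
        (t • g) - ∑ n ∈ Finset.range 10, expansionCoeff lam
          (fun n => dysonForm (freeHamiltonian h) (interactionHamiltonian v₁₂ v₂₃) T n 0 2 g)
          (fun n => dysonForm (freeHamiltonian h) (interactionHamiltonian v₁₂ v₂₃) T n 1 2 g) n
          * t ^ n) =O[𝓝 0] fun t => t ^ 10 := by
  set V := interactionHamiltonian v₁₂ v₂₃ with hV
  obtain ⟨r₀, hr₀, h₀⟩ := exists_solution_expansion h V hT g 0 10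
  obtain ⟨r₁, hr₁, h₁⟩ := exists_solution_expansion h V hT g 1 10
  have hz : ∀ n (j : Fin 3), Odd (n + j.val) → dysonForm (freeHamiltonian h) V T n j 2 g = 0 :=
    fun n j hn => dyson_eq_zero h v₁₂ v₂₃ g n T j hn
  have hz₀ : dysonForm (freeHamiltonian h) V T 0 0 2 g = 0 := by simp [dysonForm, dyson]
  have hu : ∀ᶠ t : ℝ in 𝓝 0, IsUnit (1 - volterra h V hT (t • g)) := by
    have hlim : Continuous fun t : ℝ => t • g := by fun_prop
    exact hlim.continuousAt.eventually (p := fun f => IsUnit (1 - volterra h V hT f))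
      (by simpa only [zero_smul] using eventually_isUnit h V hT)
  simp only [Finset.sum_range_succ, Finset.sum_range_zero, hz₀, hz 1 0 (by decide),
    hz 3 0 (by decide), hz 5 0 (by decide), hz 7 0 (by decide), hz 9 0 (by decide)] at h₀
  simp only [Finset.sum_range_succ, Finset.sum_range_zero, hz 0 1 (by decide),
    hz 2 1 (by decide), hz 4 1 (by decide), hz 6 1 (by decide), hz 8 1 (by decide)] at h₁
  set a := fun n => dysonForm (freeHamiltonian h) V T n 0 2 g with ha
  set b := fun n => dysonForm (freeHamiltonian h) V T n 1 2 g with hb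
  have hI : ∀ n, (-Complex.I) ^ (2 * n) = (-1) ^ n := fun n => by rw [pow_mul]; simp
  have hI' : ∀ n, (-Complex.I) ^ (2 * n + 1) = (-1) ^ n * -Complex.I := fun n => by
    rw [pow_succ, hI]
  have e₀ : ∀ᶠ t : ℝ in 𝓝 0, solution h V hT (t • g) 2 ⟨T, hT, le_rfl⟩ 0
      = -a 2 * (t ^ 2 : ℝ) + a 4 * (t ^ 4 : ℝ) - a 6 * (t ^ 6 : ℝ) + a 8 * (t ^ 8 : ℝ)
        + (t ^ 10 : ℝ) * r₀ t := by
    filter_upwards [h₀] with t ht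
    rw [ht, hI 1, hI 2, hI 3, hI 4]
    push_cast
    ring
  have e₁ : ∀ᶠ t : ℝ in 𝓝 0, solution h V hT (t • g) 2 ⟨T, hT, le_rfl⟩ 1
      = -Complex.I * (b 1 * t - b 3 * (t ^ 3 : ℝ) + b 5 * (t ^ 5 : ℝ) - b 7 * (t ^ 7 : ℝ)
        + b 9 * (t ^ 9 : ℝ)) + (t ^ 10 : ℝ) * r₁ t := by
    filter_upwards [h₁] with t ht
    rw [ht, hI' 0, hI' 1, hI' 2, hI' 3, hI' 4]
    push_cast
    ring
  have s₁ := sq_even_expansion (x := fun t => (solution h V hT (t • g) 2 ⟨T, hT, le_rfl⟩ 0).re)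
    (x₂ := (a 2).re) (x₄ := (a 4).re) (x₆ := (a 6).re) (x₈ := (a 8).re)
    (Complex.continuous_re.continuousAt.comp hr₀) (e₀.mono fun t ht => by
      rw [ht]
      simp only [Complex.add_re, Complex.sub_re, Complex.re_mul_ofReal, Complex.re_ofReal_mul,
        Complex.neg_re, Function.comp_apply])
  have s₂ := sq_even_expansion (x := fun t => (solution h V hT (t • g) 2 ⟨T, hT, le_rfl⟩ 0).im)
    (x₂ := (a 2).im) (x₄ := (a 4).im) (x₆ := (a 6).im) (x₈ := (a 8).im)
    (Complex.continuous_im.continuousAt.comp hr₀) (e₀.mono fun t ht => by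
      rw [ht]
      simp only [Complex.add_im, Complex.sub_im, Complex.im_mul_ofReal, Complex.im_ofReal_mul,
        Complex.neg_im, Function.comp_apply])
  -- Odd orders carry a factor `-i`: the real part of `-i b` is `Im b`, its imaginary part `-Re b`.
  have s₃ := sq_odd_expansion (x := fun t => (solution h V hT (t • g) 2 ⟨T, hT, le_rfl⟩ 1).re)
    (x₁ := (b 1).im) (x₃ := (b 3).im) (x₅ := (b 5).im) (x₇ := (b 7).im) (x₉ := (b 9).im)
    (Complex.continuous_re.continuousAt.comp hr₁) (e₁.mono fun t ht => by
      rw [ht, neg_mul]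
      simp only [Complex.add_re, Complex.add_im, Complex.sub_im, Complex.im_mul_ofReal,
        Complex.re_ofReal_mul, Complex.neg_re, Complex.I_mul_re, Function.comp_apply]
      ring)
  have s₄ := sq_odd_expansion (x := fun t => (solution h V hT (t • g) 2 ⟨T, hT, le_rfl⟩ 1).im)
    (x₁ := -(b 1).re) (x₃ := -(b 3).re) (x₅ := -(b 5).re) (x₇ := -(b 7).re) (x₉ := -(b 9).re)
    (Complex.continuous_im.continuousAt.comp hr₁) (e₁.mono fun t ht => by
      rw [ht, neg_mul]
      simp only [Complex.add_im, Complex.add_re, Complex.sub_re, Complex.re_mul_ofReal,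
        Complex.im_ofReal_mul, Complex.neg_im, Complex.I_mul_im, Function.comp_apply]
      ring)
  have s := ((s₁.add s₂).const_mul_left (lam 0 - lam 2)).sub
    ((s₃.add s₄).const_mul_left (lam 2 - lam 1))
  refine s.congr' ?_ .rfl
  filter_upwards [hu] with t ht
  rw [objective_eq ht (isHermitian_interactionHamiltonian v₁₂ v₂₃)]
  simp only [Finset.sum_range_succ, Finset.sum_range_zero, expansionCoeff, norm_sq_eq_re_add_im]
  ring

end

section

variable (h lam : Fin 3 → ℝ) (v₁₂ v₂₃ : ℂ) {T : ℝ}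

theorem variation_objective (hT : 0 ≤ T) (g : Control T) {n : ℕ} (hn : n < 10) :
    variation (objective (freeHamiltonian h) (interactionHamiltonian v₁₂ v₂₃) (observable lam) T)
      n 0 g = n.factorial * expansionCoeff lam
        (fun n => dysonForm (freeHamiltonian h) (interactionHamiltonian v₁₂ v₂₃) T n 0 2 g)
        (fun n => dysonForm (freeHamiltonian h) (interactionHamiltonian v₁₂ v₂₃) T n 1 2 g) n :=
  variation_eq_of_isBigO
    (analyticAt_objective h _ hT (isHermitian_interactionHamiltonian v₁₂ v₂₃) lam)
    (objective_expansion h lam v₁₂ v₂₃ hT g) hn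

end

/-! ### Controls outside the first space and inside the last one. -/

section

variable {h : Fin 3 → ℝ} {v₁₂ v₂₃ : ℂ} {ω T : ℝ}

theorem mem_spaceH1_iff (hT : 0 ≤ T) (hω₁ : h 1 - h 0 = ω) (hω₂ : h 2 - h 1 = ω)
    (hv₂₃ : v₂₃ ≠ 0) (g : Control T) :
    g ∈ spaceH1 (freeHamiltonian h) (interactionHamiltonian v₁₂ v₂₃) T ↔ amplitude ω g T = 0 := by
  change dysonForm _ _ T 1 1 2 g = 0 ↔ _
  rw [dysonForm, dyson_one_eq hT g v₁₂ v₂₃ hω₁ hω₂ T ⟨hT, le_rfl⟩, mul_eq_zero, or_iff_right hv₂₃]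

theorem dysonForm_two_eq_zero (hT : 0 ≤ T) (hω₁ : h 1 - h 0 = ω) (hω₂ : h 2 - h 1 = ω)
    {g : Control T} (hg : amplitude ω g T = 0) :
    dysonForm (freeHamiltonian h) (interactionHamiltonian v₁₂ v₂₃) T 2 0 2 g = 0 := by
  rw [dysonForm, dyson_two_zero_eq hT g v₁₂ v₂₃ hω₁ hω₂ T ⟨hT, le_rfl⟩, hg, mul_zero, mul_zero]

/-- The indicator of half a period works: there `e^{-iωs}` runs from 1 to -1, so its integral is `-2
/ (-iω)`. -/
theorem exists_notMem_spaceH1 (hT : 0 ≤ T) (hω₁ : h 1 - h 0 = ω) (hω₂ : h 2 - h 1 = ω)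
    (hω : ω ≠ 0) (hv₂₃ : v₂₃ ≠ 0) (hT₂ : 2 * Real.pi / |ω| ≤ T) :
    ∃ g : Control T, g ∉ spaceH1 (freeHamiltonian h) (interactionHamiltonian v₁₂ v₂₃) T := by
  have hr : 0 < |ω| := abs_pos.2 hω
  have hp : 0 ≤ Real.pi / |ω| := by positivity
  have hpT : Real.pi / |ω| ≤ T := by
    refine le_trans ?_ hT₂
    gcongr
    linarith [Real.pi_pos]
  let u : ℝ → ℝ := Set.indicator (Set.Icc 0 (Real.pi / |ω|)) fun _ => 1
  have hu : MemLp u 2 (volume.restrict (Set.Icc (0 : ℝ) T)) :=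
    memLp_indicator_const 2 measurableSet_Icc 1 (Or.inr (measure_ne_top _ _))
  refine ⟨hu.toLp u, ?_⟩
  rw [mem_spaceH1_iff hT hω₁ hω₂ hv₂₃, amplitude_congr hu.coeFn_toLp ⟨hT, le_rfl⟩, amplitude,
    integral_eq_of_eq_zero hp hpT fun t ht => by
      rw [wave, show u t = 0 from Set.indicator_of_notMem (fun h => absurd h.2 (not_le.2 ht)) _]
      simp]
  have hc : -Complex.I * ω ≠ 0 := by simp [hω]
  have e : ∫ s in (0 : ℝ)..Real.pi / |ω|, wave ω u s
      = ∫ s in (0 : ℝ)..Real.pi / |ω|, Complex.exp (-Complex.I * ω * s) := by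
    refine intervalIntegral.integral_congr fun s hs => ?_
    rw [Set.uIcc_of_le hp] at hs
    simp only [wave, show u s = 1 from Set.indicator_of_mem hs _, Complex.ofReal_one, one_mul]
  rw [e, integral_exp_mul_complex hc]
  have h₁ : Complex.exp (-Complex.I * ω * (Real.pi / |ω| : ℝ)) = -1 := by
    have hω' : (ω : ℂ) ≠ 0 := by exact_mod_cast hω
    rcases abs_choice ω with hs | hs
    · rw [hs, show -Complex.I * ω * (Real.pi / ω : ℝ) = -(Real.pi * Complex.I) by
        push_cast; field_simp, Complex.exp_neg, Complex.exp_pi_mul_I]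
      norm_num
    · rw [hs, show -Complex.I * ω * (Real.pi / -ω : ℝ) = Real.pi * Complex.I by
        push_cast; field_simp, Complex.exp_pi_mul_I]
  rw [h₁, Complex.ofReal_zero, mul_zero, Complex.exp_zero]
  exact div_ne_zero (by norm_num) hc

theorem memLp_specialControl (ω T : ℝ) :
    MemLp (specialControl ω) 2 (volume.restrict (Set.Icc (0 : ℝ) T)) := by
  refine MemLp.of_bound (C := 1 + Real.sqrt (19 - Real.sqrt 73) / Real.sqrt 6
    + (5 + Real.sqrt 73) / 3) ?_ (.of_forall fun t => ?_)
  · refine (Measurable.indicator ?_ measurableSet_Icc).aestronglyMeasurable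
    exact Continuous.measurable (by fun_prop)
  · refine (norm_indicator_le_norm_self _ _).trans ?_
    refine (norm_add_le _ _).trans (add_le_add ((norm_add_le _ _).trans (add_le_add ?_ ?_)) ?_)
    · simp
    · rw [norm_mul, Real.norm_of_nonneg (by positivity)]
      exact mul_le_of_le_one_right (by positivity) (Real.abs_sin_le_one _)
    · rw [norm_mul, Real.norm_of_nonneg (by positivity)]
      exact mul_le_of_le_one_right (by positivity) (Real.abs_cos_le_one _)

theorem specialControl_abs (ω : ℝ) : specialControl |ω| = specialControl ω := by
  simp [specialControl]

theorem special_moments (hω : ω ≠ 0) (hT₂ : 2 * Real.pi / |ω| ≤ T) :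
    amplitude ω (specialControl ω) T = 0 ∧ amplitudeMoment ω (specialControl ω) 2 T = 0 ∧
      amplitudeMoment ω (specialControl ω) 3 T ≠ 0 := by
  have hr : 0 < |ω| := abs_pos.2 hω
  have h₁ : amplitude |ω| (specialControl ω) T = 0 ∧
      amplitudeMoment |ω| (specialControl ω) 2 T = 0 ∧
      amplitudeMoment |ω| (specialControl ω) 3 T ≠ 0 := by
    rw [← specialControl_abs, amplitudeMoment_specialControl hr hT₂,
      amplitudeMoment_specialControl hr hT₂, integral_special_sq_eq_zero, mul_zero]
    refine ⟨amplitude_specialControl_final hr hT₂, rfl,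
      mul_ne_zero (div_ne_zero (pow_ne_zero _ (div_ne_zero Complex.I_ne_zero ?_)) ?_)
        integral_special_cube_ne_zero⟩ <;> exact_mod_cast hr.ne'
  rcases abs_choice ω with hs | hs
  · rwa [hs] at h₁
  · rw [hs, amplitude_neg, amplitudeMoment_neg, amplitudeMoment_neg] at h₁
    simpa using h₁

theorem exists_special_control (hT : 0 ≤ T) (hω₁ : h 1 - h 0 = ω) (hω₂ : h 2 - h 1 = ω)
    (hω : ω ≠ 0) (hv₁₂ : v₁₂ ≠ 0) (hv₂₃ : v₂₃ ≠ 0) (hv : ‖v₁₂‖ ≠ ‖v₂₃‖)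
    (hT₂ : 2 * Real.pi / |ω| ≤ T) :
    ∃ g : Control T, (g : ℝ → ℝ) =ᵐ[volume.restrict (Set.Icc (0 : ℝ) T)] specialControl ω ∧
      g ∈ spaceH3 (freeHamiltonian h) (interactionHamiltonian v₁₂ v₂₃) T ∧
      dysonForm (freeHamiltonian h) (interactionHamiltonian v₁₂ v₂₃) T 4 0 2 g ≠ 0 := by
  obtain ⟨m₁, m₂, m₃⟩ := special_moments hω hT₂
  have hmem := memLp_specialControl ω T
  have hae := hmem.coeFn_toLp
  have hTT : T ∈ Set.Icc 0 T := ⟨hT, le_rfl⟩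
  rw [← amplitude_congr hae hTT] at m₁
  rw [← amplitudeMoment_congr hae _ hTT] at m₂ m₃
  refine ⟨hmem.toLp _, hae, ⟨(mem_spaceH1_iff hT hω₁ hω₂ hv₂₃ _).2 m₁, ?_⟩, ?_⟩
  · rw [dysonForm, dyson_three_eq hT _ v₁₂ v₂₃ hω₁ hω₂ T hTT, m₁, m₂]
    ring
  · rw [dysonForm, dyson_four_eq hT _ v₁₂ v₂₃ hω₁ hω₂ T hTT, m₁]
    simp only [zero_mul, mul_zero, zero_add]
    -- Unequal moduli of the couplings are needed exactly for the factor `|v₂₃|² - |v₁₂|²`.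
    refine mul_ne_zero (mul_ne_zero (mul_ne_zero (mul_ne_zero hv₁₂ hv₂₃) ?_) (by norm_num)) m₃
    rw [Complex.star_def, ← Complex.normSq_eq_conj_mul_self,
      ← Complex.normSq_eq_conj_mul_self, Complex.normSq_eq_norm_sq, Complex.normSq_eq_norm_sq,
      sub_ne_zero]
    intro he
    exact hv ((pow_left_inj₀ (norm_nonneg _) (norm_nonneg _) two_ne_zero).1
      (by exact_mod_cast he.symm))

end

/-! ### Signs of one-variable expansions. -/

theorem exists_pow_lt {c : ℝ} (hc : 0 < c) {u : ℝ → ℝ} {m N : ℕ} (hmN : m < N)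
    (hu : (fun t => u t - c * t ^ m) =O[𝓝 0] fun t : ℝ => t ^ N) : ∃ t, 0 < u t := by
  have h₁ := (hu.trans_isLittleO (isLittleO_pow_pow hmN)).bound (half_pos hc)
  obtain ⟨t, ht, ht0⟩ := ((h₁.filter_mono nhdsWithin_le_nhds).and
    (self_mem_nhdsWithin (s := Set.Ioi (0 : ℝ)))).exists
  have hp : 0 < t ^ m := pow_pos ht0 m
  rw [Real.norm_of_nonneg hp.le, Real.norm_eq_abs] at ht
  have := (abs_le.1 ht).1
  exact ⟨t, by nlinarith⟩

/-- A negative quadratic term dominates near zero whatever the higher terms are. The radius depends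
on the coefficients, that is, on the direction, as the definition of a trap permits. -/
theorem exists_neighborhood_nonpos {c₂ c₄ c₆ : ℝ} (h₂ : c₂ < 0 ∨ c₂ = 0 ∧ c₄ = 0 ∧ c₆ ≤ 0) :
    ∃ ε : ℝ, 0 < ε ∧ ∀ t ∈ Set.Ioo (-ε) ε, c₂ * t ^ 2 + c₄ * t ^ 4 + c₆ * t ^ 6 ≤ 0 := by
  rcases h₂ with h₂ | ⟨rfl, rfl, h₆⟩
  · have hc : Continuous fun t : ℝ => c₂ + c₄ * t ^ 2 + c₆ * t ^ 4 := by fun_prop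
    have h₀ : ∀ᶠ t : ℝ in 𝓝 0, c₂ + c₄ * t ^ 2 + c₆ * t ^ 4 < 0 :=
      hc.continuousAt.eventually_lt continuousAt_const (by simpa using h₂)
    obtain ⟨ε, hε, hball⟩ := Metric.eventually_nhds_iff_ball.1 h₀
    refine ⟨ε, hε, fun t ht => ?_⟩
    have := hball t (by rwa [Real.ball_eq_Ioo, zero_sub, zero_add])
    nlinarith [sq_nonneg t]
  · refine ⟨1, one_pos, fun t _ => ?_⟩
    have : 0 ≤ t ^ 6 := by positivity
    nlinarith

end

end ThreeLevel

/-! ### The variations at zero and the trap of seventh order. -/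

theorem mainTheorem3 (h lam : Fin 3 → ℝ) (v₁₂ v₂₃ : ℂ) (ω T : ℝ)
    (hv₁₂ : v₁₂ ≠ 0) (hv₂₃ : v₂₃ ≠ 0)
    (hω₁ : h 1 - h 0 = ω) (hω₂ : h 2 - h 1 = ω) (hω : ω ≠ 0)
    (hlam₁₃ : lam 2 < lam 0) (hlam₃₂ : lam 1 < lam 2) (hT : 0 ≤ T)
    (H₀ V : Matrix (Fin 3) (Fin 3) ℂ) (J : Control T → ℝ)
    (hH₀ : H₀ = freeHamiltonian h) (hV : V = interactionHamiltonian v₁₂ v₂₃)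
    (hJ : J = objective H₀ V (observable lam) T) :
    -- smoothness at the zero control, and the Taylor expansion
    ContDiffAt ℝ ((⊤ : ℕ∞) : WithTop ℕ∞) J 0 ∧
    ((fun g : Control T => J (0 + g) - (J 0
        + 1 / (Nat.factorial 2 : ℝ) * variation J 2 0 g
        + 1 / (Nat.factorial 4 : ℝ) * variation J 4 0 g
        + 1 / (Nat.factorial 6 : ℝ) * variation J 6 0 g
        + 1 / (Nat.factorial 8 : ℝ) * variation J 8 0 g)) =o[𝓝 0] fun g => ‖g‖ ^ 9) ∧
    -- signs of the variations
    (∀ g, g ∉ spaceH1 H₀ V T → variation J 2 0 g < 0) ∧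
    (∀ g ∈ spaceH1 H₀ V T, variation J 2 0 g = 0 ∧ variation J 4 0 g = 0) ∧
    (∀ g ∈ spaceH1 H₀ V T, g ∉ spaceH3 H₀ V T → variation J 6 0 g < 0) ∧
    (∀ g ∈ spaceH3 H₀ V T, variation J 6 0 g = 0 ∧
      variation J 8 0 g
        = (Nat.factorial 8 : ℝ) * ((lam 0 - lam 2) * ‖dysonForm H₀ V T 4 0 2 g‖ ^ 2) ∧
      0 ≤ variation J 8 0 g) ∧
    -- the explicit control and the trap of the seventh order
    (‖v₁₂‖ ≠ ‖v₂₃‖ → 2 * Real.pi / |ω| ≤ T →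
      (∃ g : Control T,
        (g : ℝ → ℝ) =ᵐ[volume.restrict (Set.Icc (0 : ℝ) T)] specialControl ω ∧
        g ∈ spaceH3 H₀ V T ∧ 0 < variation J 8 0 g) ∧
      (∃ g : Control T, J 0 < J g) ∧
      IsTrapOfOrder J 7 0) := by
  have hJ' : J = objective (freeHamiltonian h) (interactionHamiltonian v₁₂ v₂₃) (observable lam) T := by
    rw [hJ, hH₀, hV]
  have han : AnalyticAt ℝ J 0 := by
    rw [hJ']
    exact analyticAt_objective h _ hT (isHermitian_interactionHamiltonian v₁₂ v₂₃) lam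
  set a : Control T → ℕ → ℂ := fun g n => dysonForm H₀ V T n 0 2 g with ha
  set b : Control T → ℕ → ℂ := fun g n => dysonForm H₀ V T n 1 2 g with hb
  have hvar : ∀ g, ∀ n < 10, variation J n 0 g
      = n.factorial * expansionCoeff lam (a g) (b g) n := by
    intro g n hn
    rw [ha, hb, hH₀, hV, hJ']
    exact variation_objective h lam v₁₂ v₂₃ hT g hn
  have hexp : ∀ g, (fun t : ℝ => J (t • g)
      - ∑ n ∈ Finset.range 10, expansionCoeff lam (a g) (b g) n * t ^ n) =O[𝓝 0] fun t => t ^ 10 := by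
    intro g
    rw [ha, hb, hH₀, hV, hJ']
    exact objective_expansion h lam v₁₂ v₂₃ hT g
  have hH1 : ∀ g, g ∈ spaceH1 H₀ V T ↔ b g 1 = 0 := fun g => Iff.rfl
  have hH3 : ∀ g, g ∈ spaceH3 H₀ V T ↔ b g 1 = 0 ∧ b g 3 = 0 := fun g => Iff.rfl
  -- This removes the nonnegative quartic term `(λ₁ - λ₃) |A²₁₃|²` on the first space.
  have ha₂ : ∀ g, b g 1 = 0 → a g 2 = 0 := by
    intro g hg
    rw [← hH1, hH₀, hV, mem_spaceH1_iff hT hω₁ hω₂ hv₂₃] at hg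
    change dysonForm H₀ V T 2 0 2 g = 0
    rw [hH₀, hV, dysonForm_two_eq_zero hT hω₁ hω₂ hg]
  have hμ : 0 < lam 2 - lam 1 := sub_pos.2 hlam₃₂
  have hκ : 0 < lam 0 - lam 2 := sub_pos.2 hlam₁₃
  have hodd : ∀ g, ∀ n < 10, Odd n → variation J n 0 g = 0 := by
    intro g n hn ho
    rw [hvar g n hn]
    interval_cases n <;> first | exact absurd ho (by decide) | simp [expansionCoeff]
  have h0 : ∀ g, variation J 0 0 g = J 0 := fun g => by simp [variation]
  have hfac : ∀ n : ℕ, (0 : ℝ) < n.factorial := fun n => by exact_mod_cast n.factorial_pos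
  have S2 : ∀ g, g ∉ spaceH1 H₀ V T → variation J 2 0 g < 0 := by
    intro g hg
    rw [hH1] at hg
    have : 0 < ‖b g 1‖ := norm_pos_iff.2 hg
    rw [hvar g 2 (by norm_num), expansionCoeff, mul_neg, neg_lt_zero]
    have := hfac 2
    positivity
  have S24 : ∀ g ∈ spaceH1 H₀ V T, variation J 2 0 g = 0 ∧ variation J 4 0 g = 0 := by
    intro g hg
    rw [hH1] at hg
    rw [hvar g 2 (by norm_num), hvar g 4 (by norm_num), expansionCoeff, expansionCoeff, hg,
      ha₂ g hg]
    simp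
  have E6 : ∀ g ∈ spaceH1 H₀ V T, variation J 6 0 g
      = -((Nat.factorial 6 : ℝ) * ((lam 2 - lam 1) * ‖b g 3‖ ^ 2)) := by
    intro g hg
    rw [hH1] at hg
    rw [hvar g 6 (by norm_num), expansionCoeff, hg, ha₂ g hg]
    simp
  have S6 : ∀ g ∈ spaceH1 H₀ V T, g ∉ spaceH3 H₀ V T → variation J 6 0 g < 0 := by
    intro g hg hg3
    have : 0 < ‖b g 3‖ := norm_pos_iff.2 fun h => hg3 ⟨hg, h⟩
    rw [E6 g hg, neg_lt_zero]
    have := hfac 6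
    positivity
  have E8 : ∀ g ∈ spaceH3 H₀ V T, variation J 8 0 g
      = (Nat.factorial 8 : ℝ) * ((lam 0 - lam 2) * ‖dysonForm H₀ V T 4 0 2 g‖ ^ 2) := by
    intro g hg
    obtain ⟨hg₁, hg₃⟩ := (hH3 g).1 hg
    rw [hvar g 8 (by norm_num), expansionCoeff, hg₁, hg₃, ha₂ g hg₁]
    simp [ha]
  have E60 : ∀ g ∈ spaceH3 H₀ V T, variation J 6 0 g = 0 := by
    intro g hg
    rw [E6 g hg.1, ((hH3 g).1 hg).2]
    simp
  refine ⟨han.contDiffAt, ?_, S2, S24, S6, fun g hg => ⟨E60 g hg, E8 g hg, ?_⟩, ?_⟩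
  · have h₁ := (isBigO_sub_sum_variation han 10).trans_isLittleO
      (isLittleO_norm_pow_norm_pow (show 9 < 10 by norm_num))
    refine h₁.congr_left fun g => ?_
    simp only [Finset.sum_range_succ, Finset.sum_range_zero, h0, hodd g 1 (by norm_num) (by decide),
      hodd g 3 (by norm_num) (by decide), hodd g 5 (by norm_num) (by decide),
      hodd g 7 (by norm_num) (by decide), hodd g 9 (by norm_num) (by decide), zero_add,
      Nat.factorial_zero, Nat.cast_one]
    ring
  · rw [E8 g hg]
    have := hfac 8
    positivity
  intro hv hT₂
  obtain ⟨g, hg, hg3, hg4⟩ := exists_special_control hT hω₁ hω₂ hω hv₁₂ hv₂₃ hv hT₂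
  rw [← hH₀, ← hV] at hg3 hg4
  have hpos : 0 < variation J 8 0 g := by
    rw [E8 g hg3]
    have := hfac 8
    have := norm_pos_iff.2 hg4
    positivity
  -- Along the explicit control all coefficients of orders 1 to 7 and 9 vanish and the eighth is
  -- positive, so a small multiple already increases `J`.
  have hmax : ∃ g : Control T, J 0 < J g := by
    have hc : ∀ n < 10, n ≠ 0 → n ≠ 8 → expansionCoeff lam (a g) (b g) n = 0 := by
      intro n hn h₀ h₈
      have h₁ : variation J n 0 g = 0 := by
        rcases Nat.even_or_odd n with he | ho
        · interval_cases n <;> first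
            | exact absurd rfl h₀ | exact absurd rfl h₈ | exact absurd he (by decide)
            | exact (S24 g hg3.1).1 | exact (S24 g hg3.1).2 | exact E60 g hg3
        · exact hodd g n hn ho
      rw [hvar g n hn] at h₁
      exact (mul_eq_zero.1 h₁).resolve_left (hfac n).ne'
    have hc0 : expansionCoeff lam (a g) (b g) 0 = J 0 := by
      rw [← h0 g, hvar g 0 (by norm_num)]
      simp
    have hc8 : 0 < expansionCoeff lam (a g) (b g) 8 := by
      rw [hvar g 8 (by norm_num)] at hpos
      exact (mul_pos_iff_of_pos_left (hfac 8)).1 hpos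
    obtain ⟨t, ht⟩ := exists_pow_lt (u := fun t => J (t • g) - J 0) hc8 (show 8 < 10 by norm_num)
      ((hexp g).congr_left fun t => by
        simp only [Finset.sum_range_succ, Finset.sum_range_zero, hc0, hc 1, hc 2, hc 3, hc 4, hc 5,
          hc 6, hc 7, hc 9, Nat.reduceLT, ne_eq, OfNat.ofNat_ne_zero, Nat.reduceEqDiff,
          not_false_eq_true, one_ne_zero, OfNat.one_ne_ofNat]
        ring)
    exact ⟨t • g, sub_pos.1 ht⟩
  have hpart : ∀ g, taylorPart J 7 0 g = variation J 2 0 g / (Nat.factorial 2 : ℝ)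
      + variation J 4 0 g / (Nat.factorial 4 : ℝ) + variation J 6 0 g / (Nat.factorial 6 : ℝ) := by
    intro g
    rw [taylorPart, show Finset.Icc 2 7 = {2, 3, 4, 5, 6, 7} by decide]
    simp [hodd g 3 (by norm_num) (by decide), hodd g 5 (by norm_num) (by decide),
      hodd g 7 (by norm_num) (by decide), add_assoc]
  have hR : ∀ g, ∀ t : ℝ, taylorPart J 7 0 (t • g)
      = variation J 2 0 g / (Nat.factorial 2 : ℝ) * t ^ 2
        + variation J 4 0 g / (Nat.factorial 4 : ℝ) * t ^ 4
        + variation J 6 0 g / (Nat.factorial 6 : ℝ) * t ^ 6 := by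
    intro g t
    rw [hpart, variation_smul, variation_smul, variation_smul]
    ring
  refine ⟨⟨g, hg, hg3, hpos⟩, hmax, ?_, ?_, ?_, ?_, ?_⟩
  · obtain ⟨g, hg⟩ := hmax
    exact fun h => absurd (h g) (not_le.2 hg)
  · exact han.contDiffAt
  · have h₁ := (isBigO_sub_sum_variation han 8).trans_isLittleO
      (isLittleO_norm_pow_norm_pow (show 7 < 8 by norm_num))
    refine h₁.congr_left fun g => ?_
    rw [hpart]
    simp only [Finset.sum_range_succ, Finset.sum_range_zero, h0, hodd g 1 (by norm_num) (by decide),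
      hodd g 3 (by norm_num) (by decide), hodd g 5 (by norm_num) (by decide),
      hodd g 7 (by norm_num) (by decide), zero_add, Nat.factorial_zero, Nat.cast_one]
    ring
  · obtain ⟨g, hg⟩ := exists_notMem_spaceH1 (v₁₂ := v₁₂) hT hω₁ hω₂ hω hv₂₃ hT₂
    rw [← hH₀, ← hV] at hg
    -- A Taylor part vanishing along the whole line of `g` would force its quadratic coefficient to
    -- be zero.
    by_contra! hall
    let c : ℕ → ℝ := fun n =>
      if n = 2 ∨ n = 4 ∨ n = 6 then variation J n 0 g / (n.factorial : ℝ) else 0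
    have h₁ : ∀ t : ℝ, ∑ n ∈ Finset.range 7, c n * t ^ n = 0 := by
      intro t
      have := hall (t • g)
      rw [hR] at this
      simpa [Finset.sum_range_succ, c] using this
    have h₂ : c 2 = 0 := eq_zero_of_sum_pow_isBigO (N := 7)
      ((isBigO_zero _ _).congr_left fun t => (h₁ t).symm) 2 (by norm_num)
    exact (div_neg_of_neg_of_pos (S2 g hg) (hfac 2)).ne h₂
  · intro g
    obtain ⟨ε, hε, hle⟩ := exists_neighborhood_nonpos
      (c₂ := variation J 2 0 g / (Nat.factorial 2 : ℝ))
      (c₄ := variation J 4 0 g / (Nat.factorial 4 : ℝ))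
      (c₆ := variation J 6 0 g / (Nat.factorial 6 : ℝ)) (by
        by_cases hg : g ∈ spaceH1 H₀ V T
        · refine Or.inr ⟨by rw [(S24 g hg).1, zero_div], by rw [(S24 g hg).2, zero_div], ?_⟩
          refine div_nonpos_of_nonpos_of_nonneg ?_ (hfac 6).le
          by_cases hg' : g ∈ spaceH3 H₀ V T
          · exact (E60 g hg').le
          · exact (S6 g hg hg').le
        · exact Or.inl (div_neg_of_neg_of_pos (S2 g hg) (hfac 2)))
    exact ⟨ε, hε, fun t ht => by rw [hR]; exact hle t ht⟩
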